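/- Let $\mathsf V$ be an oriented, time-oriented Lorentzian vector space of signature $(2,1)$, let $F_2$ be the free group of rank two, and let $\rho_0:F_2\to \mathrm{SO}(2,1)^0$ be the holonomy of a marked complete hyperbolic one-holed torus (cusped or of infinite area); that is, $\rho_0$ is faithful with discrete image and the axes of the hyperbolic elements $\rho_0(A),\rho_0(B)$ cross for some (equivalently, every) basis $(A,B)$ of $F_2$. Let $H^1(F_2,\mathsf V)$ be the space of translational conjugacy classes of affine deformations of $\rho_0$ and $\mathbb S H^1(F_2,\mathsf V)$ its sphere of directions. Fix an ideal point $[n_0]\in\partial \mathrm H^2$ fixed by the boundary holonomy $\rho_0(ABA^{-1}B^{-1})$ of some basis $(A,B)$. A basic triple is $(A,B,C)\in F_2^3$ with $ABC=1$ and $A,B$ generating $F_2$. An (unordered) superbasis is a class of basic triples modulo the automorphisms of $F_2$ acting as $\pm1$ on the abelianization and modulo the permutations generated by $(A,B,C)\mapsto(B^{-1},A^{-1},C^{-1})$ and $(A,B,C)\mapsto(A^{-1},C^{-1},B^{-1})$. Given a superbasis $\mathfrak b$ represented by $(A,B,C)$, let $\iota_0,\iota_1,\iota_2$ be the symmetries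 in points $t_0,t_1,t_2$ of the hyperbolic plane with $\rho_0(A)=\iota_2\iota_0$, $\rho_0(B)=\iota_0\iota_1$, $\rho_0(C)=\iota_1\iota_2$, let $[n]$ be the fixed point of $\iota_0\iota_1\iota_2$ in the $\rho_0(F_2)$-orbit of $[n_0]$, let $\Delta$ be the ideal triangle with vertices $[n],\iota_0[n],\iota_2[n]$, and let $s_0,s_1,s_2$ be the outward unit normals of its sides $([n],\iota_0[n])$, $(\iota_0[n],\iota_2[n])$, $(\iota_2[n],[n])$. Put $\mathsf V(s_i)=\{u^-s_i^--u^+s_i^+ \mid u^\pm>0\}$, where $s_i^\pm$ are future null vectors orthogonal to $s_i$ with $(s_i^-,s_i^+,s_i)$ positively oriented. The tile $\mathrm{Tile}_{\mathfrak b}\subset H^1(F_2,\mathsf V)$ is the open cone of the classes of the affine deformations $\rho$ with $\rho(A)=\tilde\iota_2\tilde\iota_0$, $\rho(B)=\tilde\iota_0\tilde\iota_1$, $\rho(C)=\tilde\iota_1\tilde\iota_2$, where $\tilde\iota_i$ is the involution in the particle $p_i+\mathbb R t_i$ and $p_i=O+q_i$ with $q_i\in\mathsf V(s_i)$ for some point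 $O$ (the vertex triple of a nondegenerate crooked ideal triangle over $\Delta$). If $\mathfrak b\ne\mathfrak b'$ are distinct superbases, then $\mathrm{Tile}_{\mathfrak b}$ and $\mathrm{Tile}_{\mathfrak b'}$ are disjoint, both as cones in $H^1(F_2,\mathsf V)$ and as regions in $\mathbb S H^1(F_2,\mathsf V)$. -/

import Mathlib

noncomputable section

namespace OneHoledTorus

/-! ### Lorentzian geometry of signature (2,1) -/

/-- The oriented Lorentzian vector space; a base point identifies Minkowski space with it. -/
abbrev V : Type := Fin 3 → ℝ

/-- The Lorentzian inner product. -/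
def lor (v w : V) : ℝ := v 0 * w 0 + v 1 * w 1 - v 2 * w 2

/-- The oriented volume form. -/
def vol (u v w : V) : ℝ := Matrix.det ![u, v, w]

/-- The hyperbolic plane: future-pointing unit timelike vectors. -/
def H2 : Set V := {t | lor t t = -1 ∧ 0 < t 2}

/-- Future-pointing nonzero null vectors; their rays are the points of the ideal boundary of the
hyperbolic plane. -/
def FutureNull : Set V := {n | lor n n = 0 ∧ 0 < n 2}

/-- The linear symmetry in the point `t` of the hyperbolic plane. -/
def pointInv (t : V) : V →ₗ[ℝ] V where
  toFun v := -v - (2 * lor v t) • t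
  map_add' v w := by
    ext i
    simp only [lor, Pi.add_apply, Pi.sub_apply, Pi.neg_apply, Pi.smul_apply, smul_eq_mul]
    ring
  map_smul' c v := by
    ext i
    simp only [lor, Pi.sub_apply, Pi.neg_apply, Pi.smul_apply, smul_eq_mul, RingHom.id_apply]
    ring

/-- The affine involution of Minkowski space fixing the particle `p + ℝ t` pointwise. -/
def particleInv (t p : V) (x : V) : V := p + pointInv t (x - p)

/-- The translational semigroup `V(s)` of the crooked halfspace directed by the unit spacelike
vector `s`: all `u⁻ s⁻ - u⁺ s⁺` with `u⁻, u⁺ > 0`, where `s⁻, s⁺` are the future null vectors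
orthogonal to `s` for which `(s⁻, s⁺, s)` is positively oriented. -/
def transSemigroup (s : V) : Set V :=
  {q | ∃ sm ∈ FutureNull, ∃ sp ∈ FutureNull, lor s sm = 0 ∧ lor s sp = 0 ∧ 0 < vol sm sp s ∧
    ∃ um up : ℝ, 0 < um ∧ 0 < up ∧ q = um • sm - up • sp}

/-- `s` is the unit spacelike vector of the geodesic with ideal endpoints `[x]` and `[y]`, whose
halfplane `{v | 0 ≤ v · s}` lies on the side opposite to the ideal point `[z]`. -/
def IsOutwardNormal (s x y z : V) : Prop :=
  lor s s = 1 ∧ lor s x = 0 ∧ lor s y = 0 ∧ lor s z < 0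

/-- `X` is a linear isometry in the identity component of `SO(2,1)`: it preserves the
inner product, the orientation and the time-orientation. -/
def IsSO21 (X : V →ₗ[ℝ] V) : Prop :=
  (∀ v w, lor (X v) (X w) = lor v w) ∧ LinearMap.det X = 1 ∧ ∀ t ∈ H2, X t ∈ H2

/-- Hyperbolic elements (transvections) of the identity component of `SO(2,1)`: the nontrivial
ones which fix a spacelike vector. -/
def IsHyperbolic (X : V →ₗ[ℝ] V) : Prop :=
  IsSO21 X ∧ X ≠ LinearMap.id ∧ ∃ a, 0 < lor a a ∧ X a = a

/-- The axis of a hyperbolic element: the geodesic orthogonal to its fixed vectors. -/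
def axis (X : V →ₗ[ℝ] V) : Set V := {t ∈ H2 | ∀ a, X a = a → lor a t = 0}

/-- The axes of `X` and `Y` are distinct geodesics which meet. -/
def AxesCross (X Y : V →ₗ[ℝ] V) : Prop :=
  IsHyperbolic X ∧ IsHyperbolic Y ∧ axis X ≠ axis Y ∧ (axis X ∩ axis Y).Nonempty

/-! ### The free group of rank two and its superbases -/

/-- The free group of rank two. -/
abbrev F2 : Type := FreeGroup (Fin 2)

/-- A basis is a pair which generates (hence freely generates) the free group. -/
def IsBasis (A B : F2) : Prop := Subgroup.closure {A, B} = ⊤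

/-- Basic triples `(A, B, C)`: `(A, B)` is a basis and `A B C = 1`. -/
structure BasicTriple where
  A : F2
  B : F2
  C : F2
  basis : IsBasis A B
  mul_eq_one : A * B * C = 1

/-- The action of automorphisms on basic triples. -/
def BasicTriple.map (φ : MulAut F2) (T : BasicTriple) : BasicTriple where
  A := φ T.A
  B := φ T.B
  C := φ T.C
  basis := by
    have h := congrArg (Subgroup.map φ.toMonoidHom) T.basis
    rw [MonoidHom.map_closure, Set.image_pair,
      Subgroup.map_top_of_surjective _ φ.surjective] at h
    exact h
  mul_eq_one := by rw [← map_mul, ← map_mul, T.mul_eq_one, map_one]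

/-- The permutation `(12)`: `(A, B, C) ↦ (B⁻¹, A⁻¹, C⁻¹)`. -/
def BasicTriple.swap12 (T : BasicTriple) : BasicTriple where
  A := T.B⁻¹
  B := T.A⁻¹
  C := T.C⁻¹
  basis := by
    have h := T.basis
    rw [IsBasis, eq_top_iff] at h ⊢
    refine h.trans ((Subgroup.closure_le _).2 ?_)
    rintro x (rfl | rfl)
    · exact inv_mem_iff.1 (Subgroup.subset_closure (by simp))
    · exact inv_mem_iff.1 (Subgroup.subset_closure (by simp))
  mul_eq_one := by
    have h := eq_inv_of_mul_eq_one_right T.mul_eq_one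
    rw [h]; group

/-- The permutation `(23)`: `(A, B, C) ↦ (A⁻¹, C⁻¹, B⁻¹)`. -/
def BasicTriple.swap23 (T : BasicTriple) : BasicTriple where
  A := T.A⁻¹
  B := T.C⁻¹
  C := T.B⁻¹
  basis := by
    have h := T.basis
    have hC := eq_inv_of_mul_eq_one_right T.mul_eq_one
    rw [IsBasis, eq_top_iff] at h ⊢
    refine h.trans ((Subgroup.closure_le _).2 ?_)
    have hA : T.A ∈ Subgroup.closure {T.A⁻¹, T.C⁻¹} :=
      inv_mem_iff.1 (Subgroup.subset_closure (by simp))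
    rintro x (rfl | rfl)
    · exact hA
    · have hAB : T.A * T.B ∈ Subgroup.closure {T.A⁻¹, T.C⁻¹} :=
        Subgroup.subset_closure (by simp [hC])
      exact (Subgroup.mul_mem_cancel_left _ hA).1 hAB
  mul_eq_one := by
    have h := eq_inv_of_mul_eq_one_right T.mul_eq_one
    rw [h]; group

/-- The automorphisms which act on the abelianization as `1` or `-1`, that is, those in the
group generated by the inner automorphisms and an elliptic involution. -/
def IsInne (φ : MulAut F2) : Prop :=
  (∀ g, Abelianization.of (φ g) = Abelianization.of g) ∨
    ∀ g, Abelianization.of (φ g) = (Abelianization.of g)⁻¹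

/-- The generators of the equivalence relation on basic triples whose classes are the unordered
superbases. -/
inductive SuperbasisStep : BasicTriple → BasicTriple → Prop
  | inne (φ : MulAut F2) (hφ : IsInne φ) (T : BasicTriple) : SuperbasisStep T (T.map φ)
  | swap12 (T : BasicTriple) : SuperbasisStep T T.swap12
  | swap23 (T : BasicTriple) : SuperbasisStep T T.swap23

/-- (Unordered) superbases: basic triples modulo the automorphisms acting as `±1` on the
abelianization and modulo permutations. -/
def Superbasis : Type := Quot SuperbasisStep

/-! ### Hyperbolic one-holed tori -/

/-- `ρ₀` is the holonomy of a marked complete hyperbolic surface which is a (cusped or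
infinite-area) one-holed torus: it is faithful with discrete image in the group of
orientation-preserving isometries of the hyperbolic plane, and some basis is represented by closed
geodesics whose axes cross. (An orientable surface with free fundamental group of rank two is
a one-holed torus or a three-holed sphere, and exactly in the first case do the axes of the
two elements of a basis cross.) -/
structure IsOneHoledTorus (ρ₀ : Representation ℝ F2 V) : Prop where
  isSO21 : ∀ g, IsSO21 (ρ₀ g)
  faithful : Function.Injective ρ₀
  discrete : DiscreteTopology (Set.range fun g => LinearMap.toMatrix' (ρ₀ g))
  cross : ∃ A B, IsBasis A B ∧ AxesCross (ρ₀ A) (ρ₀ B)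

/-- `[n]` is an ideal point fixed by the boundary holonomy `ρ₀ (A B A⁻¹ B⁻¹)`, for some
basis `(A, B)`. -/
def IsBoundaryFixedPoint (ρ₀ : Representation ℝ F2 V) (n : V) : Prop :=
  n ∈ FutureNull ∧ ∃ A B, IsBasis A B ∧ ∃ c : ℝ, ρ₀ (A * B * A⁻¹ * B⁻¹) n = c • n

/-- The ideal points `[m]` and `[n]` lie in the same orbit. -/
def SameOrbit (ρ₀ : Representation ℝ F2 V) (m n : V) : Prop :=
  ∃ g, ∃ c : ℝ, 0 < c ∧ n = c • ρ₀ g m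

/-- The symmetries `ι₀, ι₁, ι₂` in the points `t₀, t₁, t₂` of the hyperbolic plane are the Coxeter
extension of `ρ₀` with `A = ι₂ ι₀`, `B = ι₀ ι₁`, `C = ι₁ ι₂`. -/
def IsCoxeterExtension (ρ₀ : Representation ℝ F2 V) (T : BasicTriple) (t : Fin 3 → V) : Prop :=
  (∀ i, t i ∈ H2) ∧
    ρ₀ T.A = pointInv (t 2) ∘ₗ pointInv (t 0) ∧
    ρ₀ T.B = pointInv (t 0) ∘ₗ pointInv (t 1) ∧
    ρ₀ T.C = pointInv (t 1) ∘ₗ pointInv (t 2)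

/-- With `[n]` fixed by `ι₀ ι₁ ι₂`, the vectors `s₀, s₁, s₂` are the outward unit normals of the
sides `([n], ι₀[n])`, `(ι₀[n], ι₂[n])`, `(ι₂[n], [n])` of the ideal triangle with vertices
`[n], ι₀[n], ι₂[n]`. -/
def IsIdealTriangle (t : Fin 3 → V) (n : V) (s : Fin 3 → V) : Prop :=
  n ∈ FutureNull ∧
    (∃ c : ℝ, pointInv (t 0) (pointInv (t 1) (pointInv (t 2) n)) = c • n) ∧
    IsOutwardNormal (s 0) n (pointInv (t 0) n) (pointInv (t 2) n) ∧
    IsOutwardNormal (s 1) (pointInv (t 0) n) (pointInv (t 2) n) n ∧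
    IsOutwardNormal (s 2) (pointInv (t 2) n) n (pointInv (t 0) n)

/-- The affine deformation `x ↦ ρ₀(g) x + u(g)` is the restriction of the affine deformation of the
Coxeter group generated by the involutions in the particles `p i + ℝ t i`. -/
def IsRestriction (ρ₀ : Representation ℝ F2 V) (T : BasicTriple) (t p : Fin 3 → V)
    (u : F2 → V) : Prop :=
  ∀ x, ρ₀ T.A x + u T.A = particleInv (t 2) (p 2) (particleInv (t 0) (p 0) x) ∧
    ρ₀ T.B x + u T.B = particleInv (t 0) (p 0) (particleInv (t 1) (p 1) x) ∧
    ρ₀ T.C x + u T.C = particleInv (t 1) (p 1) (particleInv (t 2) (p 2) x)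

/-- The space of translational conjugacy classes of affine deformations of `ρ₀`. -/
abbrev DefSpace (ρ₀ : Representation ℝ F2 V) : Type := groupCohomology.H1 (Rep.of ρ₀)

/-- The tile of the superbasis `b`, as a cone in `H¹`: the classes of the affine deformations
coming from nondegenerate crooked ideal triangles, with vertices `p i = O + q i`,
`q i ∈ V(s i)`, over the ideal triangle of `b` having its vertices in the orbit of `[n₀]`. -/
def tileCone (ρ₀ : Representation ℝ F2 V) (n₀ : V) (b : Superbasis) : Set (DefSpace ρ₀) :=
  {c | ∃ (T : BasicTriple) (t : Fin 3 → V) (n : V) (s : Fin 3 → V) (O : V) (q : Fin 3 → V)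
      (u : groupCohomology.cocycles₁ (Rep.of ρ₀)),
    Quot.mk _ T = b ∧ IsCoxeterExtension ρ₀ T t ∧ IsIdealTriangle t n s ∧ SameOrbit ρ₀ n₀ n ∧
      (∀ i, q i ∈ transSemigroup (s i)) ∧ IsRestriction ρ₀ T t (fun i => O + q i) (fun g => u g) ∧
      c = groupCohomology.H1π (Rep.of ρ₀) u}

/-- The tile of `b` as a region in the sphere of directions of `H¹`. -/
def tile (ρ₀ : Representation ℝ F2 V) (n₀ : V) (b : Superbasis) :
    Set (Module.Ray ℝ (DefSpace ρ₀)) :=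
  {r | ∃ (c : DefSpace ρ₀) (hc : c ≠ 0), c ∈ tileCone ρ₀ n₀ b ∧ r = rayOfNeZero ℝ c hc}

end OneHoledTorus

end

/-! Fix a cocycle `u`. A basic triple determines three points `t i`, which lie on the sides of an
ideal triangle. The derivatives `dtrace` of the numbers `-2 * lor (t i) (t j)` along `u` are linear
in three strip coordinates, one for each side (`IsStripCoord`, `HasCoord`). If the class of `u` lies
in a tile, then some triple of that superbasis has three positive coordinates, because a vector of
`transSemigroup (s i)` contributes only to the coordinate of side `i`, and with positive sign
(`exists_isStripCoord_of_transSemigroup`).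

A flip replaces one side, a diagonal of an ideal quadrilateral, by the other diagonal. If the old
diagonal has a positive coordinate and the length derivatives are positive, then the new diagonal
gets a negative coordinate, while the other two coordinates and the new derivatives are positive
(`flip_strip_coord`, `HasCoord.flip`). So one may go on flipping any side except the newest. Along a
path of flips without backtracking that starts at a positive triple, exactly the newest side has a
negative coordinate (`BasicTriple.Reached.exists_hasCoord`).

Any two basic triples are joined by such a path (`BasicTriple.connected`). This rests on Nielsen's
theorem in rank two (`IsBasis.nielsenEquiv_std`), proved by cancellation estimates in a basis of
minimal total length. If a class lay in two tiles, the path between positive triples would be either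
empty, so that the superbases agree, or nonempty, and then the final triple would have both positive
coordinates and a system with a negative entry.

The contradiction needs strip coordinates to depend only on `u` and the triple (`HasCoord.unique`).
The one delicate point is the choice of the fixed point of `ι₀ι₁ι₂`: when the boundary is hyperbolic
there are two, and discreteness shows that they lie in different orbits
(`not_sameOrbit_of_eigenvectors`). -/

noncomputable section

namespace OneHoledTorus

/-! ### Geodesic prefixes and Gromov products in free groups -/

section Words

open FreeGroup

variable {α : Type*} [DecidableEq α]

/-- `p` lies on the geodesic from `1` to `g` in the Cayley tree. -/
def GeodPrefix (p g : FreeGroup α) : Prop := p.norm + (p⁻¹ * g).norm = g.norm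

theorem GeodPrefix.toWord_eq {p g : FreeGroup α} (h : GeodPrefix p g) :
    g.toWord = p.toWord ++ (p⁻¹ * g).toWord := by
  have h1 := toWord_mul_sublist p (p⁻¹ * g)
  rw [mul_inv_cancel_left] at h1
  refine h1.eq_of_length ?_
  rw [List.length_append]
  exact h.symm

theorem geodPrefix_of_toWord {p g : FreeGroup α} {l : List (α × Bool)}
    (h : g.toWord = p.toWord ++ l) : GeodPrefix p g := by
  have hl : FreeGroup.IsReduced l :=
    (isReduced_toWord (x := g)).infix ⟨p.toWord, [], by simp [h]⟩
  have hg : p⁻¹ * g = FreeGroup.mk l := by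
    rw [inv_mul_eq_iff_eq_mul, ← mk_toWord (x := g), h, ← mul_mk, mk_toWord]
  rw [GeodPrefix, hg, FreeGroup.norm, FreeGroup.norm, FreeGroup.norm, toWord_mk, hl.reduce_eq, h,
    List.length_append]

theorem GeodPrefix.of_le {p q g : FreeGroup α} (hp : GeodPrefix p g) (hq : GeodPrefix q g)
    (h : p.norm ≤ q.norm) : GeodPrefix p q := by
  have h1 : p.toWord <+: q.toWord :=
    List.prefix_of_prefix_length_le ⟨_, hp.toWord_eq.symm⟩ ⟨_, hq.toWord_eq.symm⟩ h
  obtain ⟨l, hl⟩ := h1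
  exact geodPrefix_of_toWord hl.symm

theorem GeodPrefix.eq_of_norm_eq {p q g : FreeGroup α} (hp : GeodPrefix p g)
    (hq : GeodPrefix q g) (h : p.norm = q.norm) : p = q := by
  have h1 := hp.of_le hq h.le
  rw [GeodPrefix] at h1
  have h2 : (p⁻¹ * q).norm = 0 := by omega
  exact inv_mul_eq_one.1 (norm_eq_zero.1 h2)

theorem GeodPrefix.trans {p q g : FreeGroup α} (hp : GeodPrefix p q) (hq : GeodPrefix q g) :
    GeodPrefix p g :=
  geodPrefix_of_toWord (l := (p⁻¹ * q).toWord ++ (q⁻¹ * g).toWord) (by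
    rw [← List.append_assoc, ← hp.toWord_eq, ← hq.toWord_eq])

theorem geodPrefix_mul_iff {p x : FreeGroup α} :
    GeodPrefix p (p * x) ↔ p.norm + x.norm = (p * x).norm := by
  rw [GeodPrefix, inv_mul_cancel_left]

theorem _root_.List.exists_longest_common_prefix {β : Type*} [DecidableEq β] :
    ∀ l₁ l₂ : List β, ∃ p r s, l₁ = p ++ r ∧ l₂ = p ++ s ∧ ∀ a ∈ r.head?, ∀ b ∈ s.head?, a ≠ b
  | [], l₂ => ⟨[], [], l₂, rfl, rfl, by simp⟩
  | a :: l₁, [] => ⟨[], a :: l₁, [], rfl, rfl, by simp⟩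
  | a :: l₁, b :: l₂ => by
    by_cases hab : a = b
    · obtain ⟨p, r, s, h1, h2, h3⟩ := List.exists_longest_common_prefix l₁ l₂
      exact ⟨a :: p, r, s, by simp [h1], by simp [h2, hab], h3⟩
    · exact ⟨[], a :: l₁, b :: l₂, rfl, rfl, by simpa using hab⟩

theorem exists_common_geodPrefix (g h : FreeGroup α) :
    ∃ p, GeodPrefix p g ∧ GeodPrefix p h ∧
      (g⁻¹ * h).norm = (p⁻¹ * g).norm + (p⁻¹ * h).norm := by
  obtain ⟨p, r, s, h1, h2, h3⟩ := List.exists_longest_common_prefix g.toWord h.toWord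
  have hp : FreeGroup.IsReduced p :=
    (isReduced_toWord (x := g)).infix ⟨[], r, by simp [h1]⟩
  have hr : FreeGroup.IsReduced r :=
    (isReduced_toWord (x := g)).infix ⟨p, [], by simp [h1]⟩
  have hs : FreeGroup.IsReduced s :=
    (isReduced_toWord (x := h)).infix ⟨p, [], by simp [h2]⟩
  have hpw : (FreeGroup.mk p).toWord = p := by rw [toWord_mk, hp.reduce_eq]
  have hg : (FreeGroup.mk p)⁻¹ * g = FreeGroup.mk r := by
    rw [inv_mul_eq_iff_eq_mul, ← mk_toWord (x := g), h1, ← mul_mk]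
  have hh : (FreeGroup.mk p)⁻¹ * h = FreeGroup.mk s := by
    rw [inv_mul_eq_iff_eq_mul, ← mk_toWord (x := h), h2, ← mul_mk]
  have hgh : g⁻¹ * h = FreeGroup.mk (invRev r ++ s) := by
    have : g⁻¹ * h = ((FreeGroup.mk p)⁻¹ * g)⁻¹ * ((FreeGroup.mk p)⁻¹ * h) := by group
    rw [this, hg, hh, inv_mk, mul_mk]
  have hir : FreeGroup.IsReduced (invRev r) := by
    rw [isReduced_iff_reduce_eq, reduce_invRev, hr.reduce_eq]
  have hred : FreeGroup.IsReduced (invRev r ++ s) := by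
    refine List.isChain_append.2 ⟨hir, hs, ?_⟩
    intro x hx y hy hxy
    simp only [invRev, List.getLast?_reverse, List.head?_map, Option.mem_def,
      Option.map_eq_some_iff] at hx
    obtain ⟨a, ha, rfl⟩ := hx
    have := h3 a ha y hy
    obtain ⟨a1, a2⟩ := a
    obtain ⟨y1, y2⟩ := y
    simp only [ne_eq, Prod.mk.injEq, not_and] at this hxy ⊢
    have := this hxy
    cases a2 <;> cases y2 <;> simp_all
  refine ⟨FreeGroup.mk p, geodPrefix_of_toWord (l := r) (by rw [hpw, h1]),
    geodPrefix_of_toWord (l := s) (by rw [hpw, h2]), ?_⟩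
  rw [hgh, hg, hh, FreeGroup.norm, FreeGroup.norm, FreeGroup.norm, toWord_mk, toWord_mk, toWord_mk,
    hred.reduce_eq, hr.reduce_eq, hs.reduce_eq, List.length_append, invRev_length]

/-- The Gromov product, which is the length of the longest common prefix. -/
def gromov (g h : FreeGroup α) : ℕ := (g.norm + h.norm - (g⁻¹ * h).norm) / 2

theorem gromov_eq_norm {g h p : FreeGroup α} (hg : GeodPrefix p g) (hh : GeodPrefix p h)
    (hgh : (g⁻¹ * h).norm = (p⁻¹ * g).norm + (p⁻¹ * h).norm) : gromov g h = p.norm := by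
  rw [GeodPrefix] at hg hh
  rw [gromov]
  omega

/-- The truncated subtraction and the halving in `gromov` lose nothing: the numerator is twice the
length of the longest common prefix. -/
theorem two_mul_gromov (g h : FreeGroup α) :
    2 * gromov g h + (g⁻¹ * h).norm = g.norm + h.norm := by
  obtain ⟨p, hg, hh, hgh⟩ := exists_common_geodPrefix g h
  rw [gromov_eq_norm hg hh hgh]
  rw [GeodPrefix] at hg hh
  omega

theorem exists_geodPrefix_gromov (g h : FreeGroup α) :
    ∃ p, GeodPrefix p g ∧ GeodPrefix p h ∧ p.norm = gromov g h := by
  obtain ⟨p, hg, hh, hgh⟩ := exists_common_geodPrefix g h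
  exact ⟨p, hg, hh, (gromov_eq_norm hg hh hgh).symm⟩

theorem gromov_comm (g h : FreeGroup α) : gromov g h = gromov h g := by
  have h1 := two_mul_gromov g h
  have h2 := two_mul_gromov h g
  have h3 : (g⁻¹ * h).norm = (h⁻¹ * g).norm := by
    rw [← norm_inv_eq (x := h⁻¹ * g)]; group
  omega

theorem GeodPrefix.norm_le_gromov {p g h : FreeGroup α} (hg : GeodPrefix p g)
    (hh : GeodPrefix p h) : p.norm ≤ gromov g h := by
  have h1 := two_mul_gromov g h
  have h2 : (g⁻¹ * h).norm ≤ (p⁻¹ * g).norm + (p⁻¹ * h).norm := by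
    have : g⁻¹ * h = (p⁻¹ * g)⁻¹ * (p⁻¹ * h) := by group
    rw [this, ← norm_inv_eq (x := p⁻¹ * g)]
    exact norm_mul_le _ _
  rw [GeodPrefix] at hg hh
  omega

/-- The ultrametric inequality of a tree: two prefixes of `k` are nested, so the shorter one is a
prefix of both `g` and `h`. -/
theorem min_gromov_le (g h k : FreeGroup α) : min (gromov g k) (gromov k h) ≤ gromov g h := by
  obtain ⟨p, hpg, hpk, hp⟩ := exists_geodPrefix_gromov g k
  obtain ⟨q, hqk, hqh, hq⟩ := exists_geodPrefix_gromov k h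
  rw [← hp, ← hq]
  rcases le_total p.norm q.norm with hle | hle
  · rw [min_eq_left hle]
    exact hpg.norm_le_gromov ((hpk.of_le hqk hle).trans hqh)
  · rw [min_eq_right hle]
    exact ((hqk.of_le hpk hle).trans hpg).norm_le_gromov hqh

/-- Write `y` as a reduced conjugate of a cyclically reduced word; squaring doubles this nonempty
core and keeps the conjugator. -/
theorem norm_lt_norm_mul_self {y : FreeGroup α} (hy : y ≠ 1) : y.norm < (y * y).norm := by
  have h1 := congrArg List.length (toWord_pow y 2)
  rw [sq, reduceCyclically.reduce_flatten_replicate isReduced_toWord 2, if_neg two_ne_zero]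
    at h1
  have h2 := congrArg List.length (reduceCyclically.conj_conjugator_reduceCyclically y.toWord)
  simp only [List.length_append, invRev_length] at h2
  have h3 : reduceCyclically y.toWord ≠ [] := by
    intro h0
    have h4 := reduceCyclically.conj_conjugator_reduceCyclically y.toWord
    rw [h0, List.append_nil] at h4
    apply hy
    rw [← mk_toWord (x := y), ← h4, ← mul_mk, ← inv_mk, mul_inv_cancel]
  have h5 := List.length_pos_iff.2 h3
  simp only [List.length_append, invRev_length, List.length_flatten, List.map_replicate,
    List.sum_replicate, smul_eq_mul] at h1
  rw [FreeGroup.norm, FreeGroup.norm]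
  omega

theorem two_mul_gromov_inv_self_lt {y : FreeGroup α} (hy : y ≠ 1) :
    2 * gromov y⁻¹ y < y.norm := by
  have h1 := two_mul_gromov y⁻¹ y
  have h2 := norm_lt_norm_mul_self hy
  rw [inv_inv, norm_inv_eq] at h1
  omega

end Words

/-! ### Nielsen equivalence of pairs -/

section Nielsen

open FreeGroup

variable {G : Type*} [Group G]

/-- Elementary Nielsen moves on pairs. -/
inductive NielsenStep : G × G → G × G → Prop
  | swap (A B : G) : NielsenStep (A, B) (B⁻¹, A⁻¹)
  | shear (A B : G) : NielsenStep (A, B) (A⁻¹, A * B)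
  | flip (A B : G) : NielsenStep (A, B) (A⁻¹, B)

/-- Nielsen equivalence of pairs. -/
abbrev NielsenEquiv : G × G → G × G → Prop := Relation.EqvGen NielsenStep

namespace NielsenEquiv

theorem trans {P Q R : G × G} (h : NielsenEquiv P Q) (h' : NielsenEquiv Q R) :
    NielsenEquiv P R := Relation.EqvGen.trans _ _ _ h h'

theorem symm {P Q : G × G} (h : NielsenEquiv P Q) : NielsenEquiv Q P :=
  Relation.EqvGen.symm _ _ h

theorem refl (P : G × G) : NielsenEquiv P P := Relation.EqvGen.refl _

theorem inv_left (A B : G) : NielsenEquiv (A, B) (A⁻¹, B) := .rel _ _ (.flip A B)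

theorem swap_inv (A B : G) : NielsenEquiv (A, B) (B⁻¹, A⁻¹) := .rel _ _ (.swap A B)

theorem inv_right (A B : G) : NielsenEquiv (A, B) (A, B⁻¹) := by
  have h := ((swap_inv A B).trans (inv_left _ _)).trans (swap_inv _ _)
  rwa [inv_inv, inv_inv] at h

theorem swap (A B : G) : NielsenEquiv (A, B) (B, A) := by
  have h := ((swap_inv A B).trans (inv_left _ _)).trans (inv_right _ _)
  rwa [inv_inv, inv_inv] at h

theorem mul_left (A B : G) : NielsenEquiv (A, B) (A, A * B) := by
  have h : NielsenEquiv (A, B) (A⁻¹, A * B) := .rel _ _ (.shear A B)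
  simpa using h.trans (inv_left _ _)

theorem mul_right (A B : G) : NielsenEquiv (A, B) (A, B * A) := by
  have h := (((inv_left A B).trans (inv_right _ _)).trans (mul_left _ _)).trans (inv_right _ _)
  simpa using h.trans (inv_left _ _)

theorem mul_snd (A B : G) : NielsenEquiv (A, B) (A * B, B) :=
  ((swap A B).trans (mul_right _ _)).trans (swap _ _)

theorem map {H : Type*} [Group H] (f : G →* H) {P Q : G × G} (h : NielsenEquiv P Q) :
    NielsenEquiv (f P.1, f P.2) (f Q.1, f Q.2) := by
  induction h with
  | rel x y h =>
    cases h with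
    | swap A B => simpa using swap_inv (f A) (f B)
    | shear A B =>
      have h : NielsenEquiv (f A, f B) ((f A)⁻¹, f A * f B) := .rel _ _ (.shear _ _)
      simpa using h
    | flip A B => simpa using inv_left (f A) (f B)
  | refl x => exact refl _
  | symm x y _ h => exact h.symm
  | trans x y z _ _ h h' => exact h.trans h'

theorem closure_eq {P Q : G × G} (h : NielsenEquiv P Q) :
    Subgroup.closure {P.1, P.2} = Subgroup.closure {Q.1, Q.2} := by
  have mem1 : ∀ X Y : G, X ∈ Subgroup.closure {X, Y} := fun X Y => Subgroup.subset_closure (by simp)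
  have mem2 : ∀ X Y : G, Y ∈ Subgroup.closure {X, Y} := fun X Y => Subgroup.subset_closure (by simp)
  have key : ∀ {X Y X' Y' : G}, X ∈ Subgroup.closure {X', Y'} → Y ∈ Subgroup.closure {X', Y'} →
      X' ∈ Subgroup.closure {X, Y} → Y' ∈ Subgroup.closure {X, Y} →
      Subgroup.closure {X, Y} = Subgroup.closure {X', Y'} := by
    intro X Y X' Y' h1 h2 h3 h4
    apply le_antisymm <;> rw [Subgroup.closure_le] <;> rintro z (rfl | rfl) <;> assumption
  induction h with
  | rel x y h =>
    cases h with
    | swap A B =>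
      exact key (inv_mem_iff.1 (mem2 _ _)) (inv_mem_iff.1 (mem1 _ _)) (inv_mem (mem2 _ _))
        (inv_mem (mem1 _ _))
    | shear A B =>
      have hA : A ∈ Subgroup.closure {A⁻¹, A * B} := inv_mem_iff.1 (mem1 _ _)
      exact key hA ((Subgroup.mul_mem_cancel_left _ hA).1 (mem2 _ _)) (inv_mem (mem1 _ _))
        (mul_mem (mem1 _ _) (mem2 _ _))
    | flip A B =>
      exact key (inv_mem_iff.1 (mem1 _ _)) (mem2 _ _) (inv_mem (mem1 _ _)) (mem2 _ _)
  | refl x => rfl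
  | symm x y _ h => exact h.symm
  | trans x y z _ _ h h' => exact h.trans h'

/-- Conjugation by `A` is one left multiplication followed by the inverse of a right multiplication,
and similarly for `B`. These two elements generate, and a product is handled by applying a
conjugation to a whole chain of moves. -/
theorem conj {A B : G} (hAB : Subgroup.closure {A, B} = ⊤) (g : G) :
    NielsenEquiv (A, B) (g * A * g⁻¹, g * B * g⁻¹) := by
  have hg : g ∈ Subgroup.closure {A, B} := hAB ▸ Subgroup.mem_top g
  have base : ∀ A B : G, NielsenEquiv (A, B) (A, A * B * A⁻¹) := fun A B => by
    have h := mul_right A (A * B * A⁻¹)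
    rw [inv_mul_cancel_right] at h
    exact (mul_left A B).trans h.symm
  induction hg using Subgroup.closure_induction with
  | mem x hx =>
    rcases hx with rfl | rfl
    · simpa using base x B
    · simpa using ((swap A x).trans (base x A)).trans (swap _ _)
  | one => simpa using refl (A, B)
  | mul x y _ _ hx hy =>
    have h := map (MulAut.conj x).toMonoidHom hy
    simpa [mul_assoc] using hx.trans h
  | inv x _ hx =>
    have h := map (MulAut.conj x⁻¹).toMonoidHom hx
    simpa [mul_assoc] using h.symm

end NielsenEquiv

theorem of_zero_mul_of_one_ne : (of 0 * of 1 : F2) ≠ of 1 * of 0 := by decide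

theorem IsBasis.not_commute {A B : F2} (h : IsBasis A B) : ¬ Commute A B := by
  intro hc
  have h1 : (⊤ : Subgroup F2) ≤ Subgroup.centralizer {A, B} := by
    rw [← h, Subgroup.closure_le]
    rintro x (rfl | rfl) y (rfl | rfl)
    · rfl
    · exact hc.symm
    · exact hc
    · rfl
  have h2 : (⊤ : Subgroup F2) ≤ Subgroup.centralizer ((⊤ : Subgroup F2) : Set F2) := by
    conv_lhs => rw [← h]
    rw [Subgroup.closure_le]
    rintro x (rfl | rfl) y -
    · exact (h1 (Subgroup.mem_top y) _ (by simp)).symm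
    · exact (h1 (Subgroup.mem_top y) _ (by simp)).symm
  exact of_zero_mul_of_one_ne (h2 (Subgroup.mem_top (of 1)) _ (Subgroup.mem_top (of 0)))

theorem IsBasis.ne_one {A B : F2} (h : IsBasis A B) : A ≠ 1 ∧ B ≠ 1 := by
  constructor <;> rintro rfl
  · exact h.not_commute (Commute.one_left _)
  · exact h.not_commute (Commute.one_right _)

/-- The total length of a pair. -/
def pairNorm (P : F2 × F2) : ℕ := P.1.norm + P.2.norm

/-- A basis whose total length is minimal in its Nielsen class. -/
structure IsMinimalBasis (A B : F2) : Prop where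
  basis : IsBasis A B
  le : ∀ Q, NielsenEquiv (A, B) Q → pairNorm (A, B) ≤ pairNorm Q

/-! ### Cancellation estimates in a basis of minimal length -/

namespace IsMinimalBasis

variable {x y : F2}

theorem of_equiv (h : IsMinimalBasis x y) {x' y' : F2} (he : NielsenEquiv (x, y) (x', y'))
    (hn : pairNorm (x', y') = pairNorm (x, y)) : IsMinimalBasis x' y' :=
  ⟨he.closure_eq.symm.trans h.basis, fun Q hQ => hn ▸ h.le Q (he.trans hQ)⟩

theorem swap (h : IsMinimalBasis x y) : IsMinimalBasis y x :=
  h.of_equiv (.swap x y) (by simp [pairNorm, add_comm])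

theorem inv_left (h : IsMinimalBasis x y) : IsMinimalBasis x⁻¹ y :=
  h.of_equiv (.inv_left x y) (by simp [pairNorm])

theorem inv_right (h : IsMinimalBasis x y) : IsMinimalBasis x y⁻¹ :=
  h.of_equiv (.inv_right x y) (by simp [pairNorm])

/-- Otherwise `(x * y, y)` would be shorter: at most half of `y` cancels against `x`. -/
theorem two_mul_gromov_le (h : IsMinimalBasis x y) : 2 * gromov x⁻¹ y ≤ y.norm := by
  have h1 := h.le _ (.mul_snd x y)
  have h2 := two_mul_gromov x⁻¹ y
  rw [inv_inv, norm_inv_eq] at h2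
  simp only [pairNorm] at h1
  omega

/-- In the product `x * y * x` something of the middle factor survives. If not, both cancellations
are exactly half of `y`, so `y = p * q⁻¹` with halves of equal length, while `x` begins with `q` and
ends with `p⁻¹`. Conjugating `(x * y, y)` by `q⁻¹` then gives a shorter pair. -/
theorem gromov_add_lt (h : IsMinimalBasis x y) :
    gromov x⁻¹ y + gromov y⁻¹ x < y.norm := by
  have h1 := h.two_mul_gromov_le
  have h2 := h.swap.inv_left.inv_right.two_mul_gromov_le
  have h3 := h.inv_left.inv_right.swap.two_mul_gromov_le
  have h5 := h.swap.two_mul_gromov_le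
  have h5' := h.inv_right.two_mul_gromov_le
  have h6 := h.swap.inv_left.inv_right.swap.two_mul_gromov_le
  simp only [inv_inv, norm_inv_eq] at h1 h2 h3 h5 h5' h6
  rw [gromov_comm y x⁻¹] at h2
  have h4 : 2 * gromov y⁻¹ x ≤ y.norm := by
    have := h.inv_left.inv_right.two_mul_gromov_le
    rw [inv_inv, norm_inv_eq, gromov_comm] at this
    exact this
  by_contra hcon
  obtain ⟨p, hpx, hpy, hp⟩ := exists_geodPrefix_gromov x⁻¹ y
  obtain ⟨q, hqy, hqx, hq⟩ := exists_geodPrefix_gromov y⁻¹ x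
  have hm1 : 2 * p.norm = y.norm := by omega
  have hm2 : 2 * q.norm = y.norm := by omega
  obtain ⟨y', rfl⟩ : ∃ y', y = y' * q⁻¹ := ⟨y * q, by group⟩
  have e1 : (q⁻¹ * (y' * q⁻¹)⁻¹).norm = y'.norm := by
    rw [← norm_inv_eq]; congr 1; group
  have hy' : y'.norm = q.norm := by
    have := hqy
    rw [GeodPrefix, norm_inv_eq, e1] at this
    omega
  have hyp : p = y' := by
    refine hpy.eq_of_norm_eq (geodPrefix_mul_iff.2 ?_) (by omega)
    rw [norm_inv_eq]; omega
  subst hyp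
  obtain ⟨x', rfl⟩ : ∃ x', x = q * x' := ⟨q⁻¹ * x, by group⟩
  rw [geodPrefix_mul_iff] at hqx
  have hx'p : GeodPrefix x'⁻¹ (q * x')⁻¹ := by
    rw [mul_inv_rev, geodPrefix_mul_iff, norm_inv_eq, norm_inv_eq, ← mul_inv_rev, norm_inv_eq,
      ← hqx, add_comm]
  have hpx' : GeodPrefix p x'⁻¹ := hpx.of_le hx'p (by rw [norm_inv_eq]; omega)
  -- Here `x` has become `q * x'`. The first conjugate is `x' * p`, shorter than `x` by the length
  -- of `y`; the second is `q⁻¹ * p`, no longer than `y`.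
  have hle := h.le _ ((NielsenEquiv.mul_snd _ _).trans
    (NielsenEquiv.conj ((NielsenEquiv.mul_snd _ _).closure_eq.symm.trans h.basis) q⁻¹))
  have e2 : q⁻¹ * (q * x' * (p * q⁻¹)) * q⁻¹⁻¹ = (p⁻¹ * x'⁻¹)⁻¹ := by group
  have e3 : q⁻¹ * (p * q⁻¹) * q⁻¹⁻¹ = q⁻¹ * p := by group
  have h7 := norm_mul_le q⁻¹ p
  have hy0 : (p * q⁻¹).norm ≠ 0 := fun h0 => h.basis.ne_one.2 (norm_eq_zero.1 h0)
  rw [GeodPrefix, norm_inv_eq] at hpx'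
  simp only [pairNorm] at hle
  rw [e2, e3, norm_inv_eq] at hle
  rw [norm_inv_eq] at h7
  omega

/-- The elements represented by letters. -/
def letter (A B : F2) (l : Fin 2 × Bool) : F2 := FreeGroup.lift ![A, B] (FreeGroup.mk [l])

theorem letter_not (A B : F2) (i : Fin 2) (b : Bool) :
    letter A B (i, !b) = (letter A B (i, b))⁻¹ := by
  cases b <;> simp [letter]

theorem letter_of_ne {A B : F2} (h : IsMinimalBasis A B) {l m : Fin 2 × Bool} (hlm : l.1 ≠ m.1) :
    IsMinimalBasis (letter A B l) (letter A B m) := by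
  obtain ⟨i, b⟩ := l
  obtain ⟨j, c⟩ := m
  have h1 := h.inv_left
  have h2 := h.inv_right
  have h3 := h.inv_left.inv_right
  have h' := h.swap
  have h1' := h1.swap
  have h2' := h2.swap
  have h3' := h3.swap
  fin_cases i <;> fin_cases j <;> cases b <;> cases c <;> simp_all [letter]

theorem letter_ne_one {A B : F2} (h : IsMinimalBasis A B) (l : Fin 2 × Bool) :
    letter A B l ≠ 1 := by
  have h1 : l.1 ≠ (l.1 + 1, true).1 := by
    obtain ⟨i, b⟩ := l
    fin_cases i <;> simp
  exact (h.letter_of_ne h1).basis.ne_one.1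

theorem two_mul_gromov_letter_le {A B : F2} (h : IsMinimalBasis A B) {l m : Fin 2 × Bool}
    (hlm : l.1 = m.1 → l.2 = m.2) :
    2 * gromov (letter A B l)⁻¹ (letter A B m) ≤ (letter A B m).norm ∧
      2 * gromov (letter A B l)⁻¹ (letter A B m) ≤ (letter A B l).norm := by
  by_cases h1 : l.1 = m.1
  · obtain rfl : l = m := Prod.ext h1 (hlm h1)
    have := two_mul_gromov_inv_self_lt (h.letter_ne_one l)
    exact ⟨this.le, this.le⟩
  · have h2 := h.letter_of_ne h1
    refine ⟨h2.two_mul_gromov_le, ?_⟩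
    have := h2.swap.inv_left.inv_right.two_mul_gromov_le
    rw [inv_inv, norm_inv_eq] at this
    rw [gromov_comm]
    exact this

/-- Each cancellation takes at most half of the middle letter, so only two exact halves must be
excluded. Equal neighbours are excluded by the strict bound for squares and the pattern `x y x` by
`gromov_add_lt`. In the pattern `x y x⁻¹`, the ultrametric inequality would make `y⁻¹` and `y` share
a prefix of half their length. -/
theorem gromov_letter_add_lt {A B : F2} (h : IsMinimalBasis A B) {l m k : Fin 2 × Bool}
    (hlm : l.1 = m.1 → l.2 = m.2) (hmk : m.1 = k.1 → m.2 = k.2) :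
    gromov (letter A B l)⁻¹ (letter A B m) + gromov (letter A B m)⁻¹ (letter A B k) <
      (letter A B m).norm := by
  have a1 := (h.two_mul_gromov_letter_le hlm).1
  have a2 := (h.two_mul_gromov_letter_le hmk).2
  by_cases h1 : l.1 = m.1
  · obtain rfl : l = m := Prod.ext h1 (hlm h1)
    have := two_mul_gromov_inv_self_lt (h.letter_ne_one l)
    omega
  by_cases h2 : m.1 = k.1
  · obtain rfl : m = k := Prod.ext h2 (hmk h2)
    have := two_mul_gromov_inv_self_lt (h.letter_ne_one m)
    omega
  have h3 : l.1 = k.1 := by omega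
  by_cases h4 : l.2 = k.2
  · obtain rfl : l = k := Prod.ext h3 h4
    exact (h.letter_of_ne h1).gromov_add_lt
  · have h5 : letter A B k = (letter A B l)⁻¹ := by
      rw [← letter_not]
      congr 1
      refine Prod.ext h3.symm ?_
      simp only
      cases hl : l.2 <;> cases hk : k.2 <;> simp_all
    rw [h5] at a2 ⊢
    have h6 := min_gromov_le (letter A B m)⁻¹ (letter A B m) (letter A B l)⁻¹
    have h7 := two_mul_gromov_inv_self_lt (h.letter_ne_one m)
    omega

/-- The element represented by a word. -/
def word (A B : F2) (L : List (Fin 2 × Bool)) : F2 := (L.map (letter A B)).prod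

theorem lift_eq_word (A B : F2) (g : F2) : FreeGroup.lift ![A, B] g = word A B g.toWord := by
  conv_lhs => rw [← mk_toWord (x := g)]
  generalize g.toWord = L
  induction L with
  | nil => rfl
  | cons l L ih =>
    have : (FreeGroup.mk (l :: L) : F2) = FreeGroup.mk [l] * FreeGroup.mk L := by simp
    rw [this, MonoidHom.map_mul, ih]
    simp [word, letter]

/-- Since part of every interior letter survives, the cancellation at the front is decided by the
first two letters alone. The length bound carried through the induction makes reduced words with at
least two letters longer than `1`. -/
theorem gromov_word {A B : F2} (h : IsMinimalBasis A B) :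
    ∀ (L : List (Fin 2 × Bool)) (l m : Fin 2 × Bool), FreeGroup.IsReduced (l :: m :: L) →
      gromov (letter A B l)⁻¹ (word A B (m :: L)) = gromov (letter A B l)⁻¹ (letter A B m) ∧
      (letter A B l).norm + 1 ≤ gromov (letter A B l)⁻¹ (letter A B m) +
        (word A B (l :: m :: L)).norm := by
  intro L
  induction L with
  | nil =>
    intro l m hr
    rw [FreeGroup.isReduced_cons_cons] at hr
    have h1 := h.two_mul_gromov_letter_le hr.1
    have h2 := two_mul_gromov (letter A B l)⁻¹ (letter A B m)
    have h3 : (letter A B m).norm ≠ 0 := fun h0 => h.letter_ne_one m (norm_eq_zero.1 h0)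
    rw [inv_inv, norm_inv_eq] at h2
    refine ⟨by simp [word], ?_⟩
    simp only [word, List.map_cons, List.map_nil, List.prod_cons, List.prod_nil, mul_one]
    omega
  | cons k L ih =>
    intro l m hr
    rw [FreeGroup.isReduced_cons_cons] at hr
    obtain ⟨hlm, hr⟩ := hr
    obtain ⟨ih1, ih2⟩ := ih m k hr
    rw [FreeGroup.isReduced_cons_cons] at hr
    have hN := h.gromov_letter_add_lt hlm hr.1
    set x := letter A B l
    set y := letter A B m
    set z := letter A B k
    have hw : ∀ j L', word A B (j :: L') = letter A B j * word A B L' := fun j L' => by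
      simp [word]
    set w := word A B (k :: L)
    have hyw : word A B (m :: k :: L) = y * w := hw _ _
    have g1 := two_mul_gromov y⁻¹ w
    have g2 := two_mul_gromov y (y * w)
    rw [inv_mul_cancel_left] at g2
    rw [inv_inv, norm_inv_eq] at g1
    have hg : gromov y (y * w) + gromov y⁻¹ z = y.norm := by omega
    have m1 := min_gromov_le x⁻¹ (y * w) y
    have m2 := min_gromov_le x⁻¹ y (y * w)
    have hb := (h.two_mul_gromov_letter_le hlm)
    rw [gromov_comm (y * w) y] at m2
    have e1 : gromov x⁻¹ (y * w) = gromov x⁻¹ y := by omega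
    have g3 := two_mul_gromov x⁻¹ (y * w)
    rw [inv_inv, norm_inv_eq] at g3
    rw [hyw] at ih2
    have hxyw : word A B (l :: m :: k :: L) = x * (y * w) := by rw [hw, hyw]
    rw [hyw, hxyw]
    exact ⟨e1, by omega⟩

theorem exists_letter_of_norm_eq_one {A B : F2} (h : IsMinimalBasis A B) {g : F2}
    (hg : g.norm = 1) : ∃ l, g = letter A B l := by
  have hs : Function.Surjective (FreeGroup.lift ![A, B] : F2 →* F2) := by
    rw [← MonoidHom.range_eq_top, eq_top_iff, ← h.basis, Subgroup.closure_le]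
    rintro x (rfl | rfl)
    · exact ⟨of 0, by simp⟩
    · exact ⟨of 1, by simp⟩
  obtain ⟨w, rfl⟩ := hs g
  have hr := isReduced_toWord (x := w)
  rw [lift_eq_word] at hg ⊢
  rcases hL : w.toWord with _ | ⟨l, _ | ⟨m, L⟩⟩
  · rw [hL] at hg; simp [word] at hg
  · exact ⟨l, by simp [word]⟩
  · rw [hL] at hg hr
    have h1 := (h.gromov_word L l m hr).2
    have h2 := (h.two_mul_gromov_letter_le (FreeGroup.isReduced_cons_cons.1 hr).1).2
    have h3 : (letter A B l).norm ≠ 0 := fun h0 => h.letter_ne_one l (norm_eq_zero.1 h0)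
    omega

/-- The standard generators have length `1`, hence are letters in `A` and `B`; they are distinct and
not mutually inverse, so they use both. -/
theorem nielsenEquiv_std {A B : F2} (h : IsMinimalBasis A B) :
    NielsenEquiv (A, B) (of 0, of 1) := by
  obtain ⟨⟨i, b⟩, hl⟩ := h.exists_letter_of_norm_eq_one (FreeGroup.norm_of (0 : Fin 2))
  obtain ⟨⟨j, c⟩, hm⟩ := h.exists_letter_of_norm_eq_one (FreeGroup.norm_of (1 : Fin 2))
  rw [hl, hm]
  have n1 : (of 0 : F2) ≠ of 1 := by decide
  have n2 : (of 0 : F2) ≠ (of 1)⁻¹ := by decide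
  have hij : i ≠ j := by
    rintro rfl
    by_cases hbc : b = c
    · subst hbc; exact n1 (hl.trans hm.symm)
    · have : c = !b := by cases b <;> cases c <;> simp_all
      rw [this, letter_not, ← hl] at hm
      exact n2 (by rw [hm, inv_inv])
  have e1 := NielsenEquiv.refl (A, B)
  have e2 := NielsenEquiv.inv_left A B
  have e3 := NielsenEquiv.inv_right A B
  have e4 := e3.trans (NielsenEquiv.inv_left _ _)
  have f1 := NielsenEquiv.swap A B
  have f2 := e2.trans (NielsenEquiv.swap _ _)
  have f3 := e3.trans (NielsenEquiv.swap _ _)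
  have f4 := e4.trans (NielsenEquiv.swap _ _)
  clear hl hm h
  fin_cases i <;> fin_cases j <;> cases b <;> cases c <;> simp_all [letter]

end IsMinimalBasis

/-- Nielsen's theorem in rank two: all bases are related by elementary Nielsen moves. -/
theorem IsBasis.nielsenEquiv_std {A B : F2} (h : IsBasis A B) :
    NielsenEquiv (A, B) (of 0, of 1) := by
  obtain ⟨⟨A', B'⟩, hQ, hmin⟩ := WellFounded.has_min (measure pairNorm).wf
    {Q | NielsenEquiv (A, B) Q} ⟨_, NielsenEquiv.refl _⟩
  have hm : IsMinimalBasis A' B' :=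
    ⟨(NielsenEquiv.closure_eq hQ).symm.trans h, fun Q hQ' =>
      not_lt.1 (hmin Q (NielsenEquiv.trans hQ hQ'))⟩
  exact NielsenEquiv.trans hQ hm.nielsenEquiv_std

end Nielsen


section Triples

open FreeGroup

/-! ### Moves on basic triples -/

namespace BasicTriple

theorem C_eq (T : BasicTriple) : T.C = (T.A * T.B)⁻¹ := eq_inv_of_mul_eq_one_right T.mul_eq_one

theorem ext_AB {T U : BasicTriple} (hA : T.A = U.A) (hB : T.B = U.B) : T = U := by
  have hC : T.C = U.C := by rw [C_eq, C_eq, hA, hB]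
  cases T; cases U
  simp only at hA hB hC
  subst hA hB hC
  rfl

/-- The basic triple of a basis. -/
def ofBasis {A B : F2} (h : IsBasis A B) : BasicTriple := ⟨A, B, (A * B)⁻¹, h, mul_inv_cancel _⟩

/-- The flip `(A, B) ↦ (A⁻¹, B)`. -/
def flip (T : BasicTriple) : BasicTriple :=
  ofBasis (A := T.A⁻¹) (B := T.B)
    ((NielsenEquiv.inv_left T.A T.B).closure_eq.symm.trans T.basis)

/-- The elliptic involution `(A, B) ↦ (A⁻¹, B⁻¹)`. -/
def eps (T : BasicTriple) : BasicTriple :=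
  ofBasis (A := T.A⁻¹) (B := T.B⁻¹)
    (((NielsenEquiv.inv_left T.A T.B).trans (.inv_right _ _)).closure_eq.symm.trans T.basis)

/-- Conjugation of a basic triple. -/
def conj (g : F2) (T : BasicTriple) : BasicTriple := T.map (MulAut.conj g)

theorem swap12_swap12 (T : BasicTriple) : T.swap12.swap12 = T :=
  ext_AB (inv_inv _) (inv_inv _)

theorem swap23_swap23 (T : BasicTriple) : T.swap23.swap23 = T :=
  ext_AB (inv_inv _) (inv_inv _)

theorem flip_flip (T : BasicTriple) : T.flip.flip = T := ext_AB (inv_inv _) rfl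

theorem braid (T : BasicTriple) :
    T.swap23.swap12.swap23 = T.swap12.swap23.swap12 := by
  apply ext_AB <;> simp [swap12, swap23]

theorem flip_eps (T : BasicTriple) : T.eps.flip = T.flip.eps := rfl

theorem swap12_eps (T : BasicTriple) : T.eps.swap12 = T.swap12.eps := ext_AB rfl rfl

theorem swap12_flip (T : BasicTriple) : T.swap12.flip = T.flip.swap12.eps := by
  apply ext_AB <;> simp [flip, eps, swap12, ofBasis]

/-- The third entry of `T.eps` is `B * A` and not `C⁻¹ = A * B`; conjugation by `A⁻¹` repairs this.
-/
theorem swap23_eps (T : BasicTriple) : T.eps.swap23 = T.swap23.eps.conj T.A⁻¹ := by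
  apply ext_AB <;> simp [eps, swap23, conj, ofBasis, C_eq, map, mul_assoc]

theorem conj_flip (g : F2) (T : BasicTriple) : (T.conj g).flip = T.flip.conj g := by
  apply ext_AB <;> simp [flip, conj, map, ofBasis, mul_assoc]

theorem conj_swap12 (g : F2) (T : BasicTriple) : (T.conj g).swap12 = T.swap12.conj g := by
  apply ext_AB <;> simp [swap12, conj, map, mul_assoc]

theorem conj_swap23 (g : F2) (T : BasicTriple) : (T.conj g).swap23 = T.swap23.conj g := by
  apply ext_AB <;> simp [swap23, conj, map, mul_assoc]

/-- A property of basic triples stable under the elementary moves holds for all basic triples as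
soon as it holds for one. -/
theorem forall_of_moves {M : BasicTriple → Prop} (h12 : ∀ T, M T → M T.swap12)
    (h23 : ∀ T, M T → M T.swap23) (hf : ∀ T, M T → M T.flip) {T₀ : BasicTriple} (h₀ : M T₀)
    (T : BasicTriple) : M T := by
  let M' : F2 × F2 → Prop := fun P => ∃ h : IsBasis P.1 P.2, M (ofBasis h)
  -- On the first two entries, the three Nielsen steps are exactly `swap12`, `swap23` and `flip`.
  have step : ∀ {P Q}, NielsenStep P Q → M' P → M' Q := by
    rintro P Q (⟨A, B⟩ | ⟨A, B⟩ | ⟨A, B⟩) ⟨h, hM⟩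
    · exact ⟨(ofBasis h).swap12.basis, by convert h12 _ hM using 1; exact ext_AB rfl rfl⟩
    · have e : (ofBasis h).swap23.B = A * B := inv_inv _
      exact ⟨e ▸ (ofBasis h).swap23.basis, by
        convert h23 _ hM using 1; exact ext_AB rfl e.symm⟩
    · exact ⟨(ofBasis h).flip.basis, by convert hf _ hM using 1; exact ext_AB rfl rfl⟩
  have inv : ∀ {P Q : F2 × F2}, NielsenStep P Q → NielsenStep Q P := by
    rintro P Q (⟨A, B⟩ | ⟨A, B⟩ | ⟨A, B⟩)
    · simpa using NielsenStep.swap B⁻¹ A⁻¹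
    · simpa using NielsenStep.shear A⁻¹ (A * B)
    · simpa using NielsenStep.flip A⁻¹ B
  have equiv : ∀ {P Q}, NielsenEquiv P Q → (M' P ↔ M' Q) := by
    intro P Q h
    induction h with
    | rel x y h => exact ⟨step h, step (inv h)⟩
    | refl x => rfl
    | symm x y _ h => exact h.symm
    | trans x y z _ _ h h' => exact h.trans h'
  have e : ∀ U : BasicTriple, ofBasis U.basis = U := fun U => ext_AB rfl rfl
  obtain ⟨_, h⟩ := (equiv (T₀.basis.nielsenEquiv_std.trans T.basis.nielsenEquiv_std.symm)).1
    ⟨T₀.basis, by rwa [e]⟩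
  rwa [e] at h

/-- An involutive endomorphism as an automorphism. -/
def mulAutOfInvolutive (f : F2 →* F2) (hf : f.comp f = MonoidHom.id F2) : MulAut F2 :=
  MonoidHom.toMulEquiv f f hf hf

/-- Generating pairs are free bases: every elementary move is precomposition with an involutive
automorphism of the standard basis. -/
theorem exists_mulAut (T : BasicTriple) : ∃ ψ : MulAut F2, ψ (of 0) = T.A ∧ ψ (of 1) = T.B := by
  have std : IsBasis (of 0 : F2) (of 1) := by
    rw [IsBasis, ← FreeGroup.closure_range_of]
    congr 1
    ext x
    simp [Fin.exists_fin_two, eq_comm]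
  refine forall_of_moves (M := fun T => ∃ ψ : MulAut F2, ψ (of 0) = T.A ∧ ψ (of 1) = T.B)
    ?_ ?_ ?_ (T₀ := ofBasis std) ⟨1, rfl, rfl⟩ T
  · rintro T ⟨ψ, h0, h1⟩
    refine ⟨ψ * mulAutOfInvolutive (FreeGroup.lift ![(of 1)⁻¹, (of 0)⁻¹])
      (FreeGroup.ext_hom _ _ fun i => ?_), ?_, ?_⟩
    · fin_cases i <;> simp
    · simp [mulAutOfInvolutive, h1, swap12]
    · simp [mulAutOfInvolutive, h0, swap12]
  · rintro T ⟨ψ, h0, h1⟩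
    refine ⟨ψ * mulAutOfInvolutive (FreeGroup.lift ![(of 0)⁻¹, of 0 * of 1])
      (FreeGroup.ext_hom _ _ fun i => ?_), ?_, ?_⟩
    · fin_cases i <;> simp
    · simp [mulAutOfInvolutive, h0, swap23]
    · simp [mulAutOfInvolutive, h0, h1, swap23, C_eq]
  · rintro T ⟨ψ, h0, h1⟩
    refine ⟨ψ * mulAutOfInvolutive (FreeGroup.lift ![(of 0)⁻¹, of 1])
      (FreeGroup.ext_hom _ _ fun i => ?_), ?_, ?_⟩
    · fin_cases i <;> simp
    · simp [mulAutOfInvolutive, h0, flip, ofBasis]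
    · simp [mulAutOfInvolutive, h1, flip, ofBasis]

theorem mk_conj (g : F2) (T : BasicTriple) :
    Quot.mk SuperbasisStep (T.conj g) = Quot.mk SuperbasisStep T := by
  refine (Quot.sound (.inne _ (Or.inl fun x => ?_) T)).symm
  simp

theorem mk_eps (T : BasicTriple) :
    Quot.mk SuperbasisStep T.eps = Quot.mk SuperbasisStep T := by
  obtain ⟨ψ, h0, h1⟩ := T.exists_mulAut
  let ε : MulAut F2 := mulAutOfInvolutive (FreeGroup.lift ![(of 0)⁻¹, (of 1)⁻¹])
    (FreeGroup.ext_hom _ _ fun i => by fin_cases i <;> simp)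
  have hA : (ψ * ε * ψ⁻¹) T.A = T.A⁻¹ := by
    simp [← h0, ε, mulAutOfInvolutive]
  have hB : (ψ * ε * ψ⁻¹) T.B = T.B⁻¹ := by
    simp [← h1, ε, mulAutOfInvolutive]
  have hT : T.eps = T.map (ψ * ε * ψ⁻¹) := ext_AB hA.symm hB.symm
  rw [hT]
  refine (Quot.sound (.inne _ (Or.inr fun x => ?_) T)).symm
  -- The action by `-1` on the abelianization has to be checked only on the generators `T.A` and
  -- `T.B`.
  have h : (Abelianization.of.comp (ψ * ε * ψ⁻¹).toMonoidHom : F2 →* Abelianization F2) =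
      (Abelianization.of)⁻¹ := by
    refine MonoidHom.eq_of_eqOn_dense T.basis ?_
    rintro y (rfl | rfl)
    · change Abelianization.of ((ψ * ε * ψ⁻¹) T.A) = _
      rw [hA]; simp
    · change Abelianization.of ((ψ * ε * ψ⁻¹) T.B) = _
      rw [hB]; simp
  exact DFunLike.congr_fun h x

/-! ### Paths without backtracking in the tree of superbases -/

/-- Triples related by permutations, conjugations and the elliptic involution. -/
inductive Similar (T₀ : BasicTriple) : BasicTriple → Prop
  | refl : Similar T₀ T₀
  | swap12 {T} : Similar T₀ T → Similar T₀ T.swap12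
  | swap23 {T} : Similar T₀ T → Similar T₀ T.swap23
  | eps {T} : Similar T₀ T → Similar T₀ T.eps
  | conj {T} (g : F2) : Similar T₀ T → Similar T₀ (T.conj g)

theorem Similar.mk_eq {T₀ T : BasicTriple} (h : Similar T₀ T) :
    Quot.mk SuperbasisStep T = Quot.mk SuperbasisStep T₀ := by
  induction h with
  | refl => rfl
  | @swap12 T _ ih => exact (Quot.sound (.swap12 T)).symm.trans ih
  | @swap23 T _ ih => exact (Quot.sound (.swap23 T)).symm.trans ih
  | @eps T _ ih => exact T.mk_eps.trans ih
  | @conj T g _ ih => exact (T.mk_conj g).trans ih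

/-- `Reached T₀ T k`: there is a nonempty path of flips without backtracking from `T₀` to `T`,
the last of which created the arc with index `k`. -/
inductive Reached (T₀ : BasicTriple) : BasicTriple → Fin 3 → Prop
  | first {T} : Similar T₀ T → Reached T₀ T.flip 0
  | step {T k} : Reached T₀ T k → k ≠ 0 → Reached T₀ T.flip 0
  | swap12 {T k} : Reached T₀ T k → Reached T₀ T.swap12 (Equiv.swap 1 2 k)
  | swap23 {T k} : Reached T₀ T k → Reached T₀ T.swap23 (Equiv.swap 0 2 k)
  | eps {T k} : Reached T₀ T k → Reached T₀ T.eps k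
  | conj {T k} (g : F2) : Reached T₀ T k → Reached T₀ (T.conj g) k

/-- There is a path of flips without backtracking from `T₀` to `T`. -/
def Connected (T₀ T : BasicTriple) : Prop := Similar T₀ T ∨ ∃ k, Reached T₀ T k

namespace Connected

variable {T₀ T : BasicTriple}

theorem swap12 : Connected T₀ T → Connected T₀ T.swap12
  | .inl h => .inl h.swap12
  | .inr ⟨_, h⟩ => .inr ⟨_, h.swap12⟩

theorem swap23 : Connected T₀ T → Connected T₀ T.swap23
  | .inl h => .inl h.swap23
  | .inr ⟨_, h⟩ => .inr ⟨_, h.swap23⟩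

theorem eps : Connected T₀ T → Connected T₀ T.eps
  | .inl h => .inl h.eps
  | .inr ⟨_, h⟩ => .inr ⟨_, h.eps⟩

theorem conj (g : F2) : Connected T₀ T → Connected T₀ (T.conj g)
  | .inl h => .inl (h.conj g)
  | .inr ⟨_, h⟩ => .inr ⟨_, h.conj g⟩

end Connected

/-- The flip of the arc with index `k`. -/
def flipAt (T : BasicTriple) (k : Fin 3) : BasicTriple :=
  ![T.flip, T.swap12.swap23.flip, T.swap23.flip] k

/-- Flipping the newest arc again retracts the last edge of the path. Permutations only relabel that
arc; `braid` handles the one index which the swap leaves alone but whose flip uses two swaps. -/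
theorem Reached.connected_flipAt {T₀ T : BasicTriple} {k : Fin 3} (h : Reached T₀ T k) :
    Connected T₀ (T.flipAt k) := by
  induction h with
  | @first T h => exact .inl (by rwa [flipAt, Matrix.cons_val_zero, flip_flip])
  | @step T k h _ _ => exact .inr ⟨k, by rwa [flipAt, Matrix.cons_val_zero, flip_flip]⟩
  | @swap12 T k _ ih =>
    fin_cases k
    · have := ih.swap12.eps
      simpa [flipAt, swap12_flip, Equiv.swap_apply_of_ne_of_ne] using this
    · simpa [flipAt] using ih
    · simpa [flipAt, swap12_swap12] using ih
  | @swap23 T k _ ih =>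
    fin_cases k
    · simpa [flipAt, swap23_swap23] using ih
    · have := ih.swap12.eps
      simp only [flipAt] at this ⊢
      simpa [braid, Equiv.swap_apply_of_ne_of_ne, swap12_flip] using this
    · simpa [flipAt] using ih
  | @eps T k _ ih =>
    fin_cases k
    · exact ih.eps
    · have := ih.eps.conj T.swap12.A⁻¹
      simpa [flipAt, swap12_eps, swap23_eps, conj_flip, flip_eps] using this
    · have := ih.eps.conj T.A⁻¹
      simpa [flipAt, swap23_eps, conj_flip, flip_eps] using this
  | @conj T k g _ ih =>
    have := ih.conj g
    fin_cases k <;> simpa [flipAt, conj_flip, conj_swap12, conj_swap23] using this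

/-- Any two basic triples are connected by a path of flips without backtracking. -/
theorem connected (T₀ T : BasicTriple) : Connected T₀ T := by
  refine forall_of_moves (fun _ h => h.swap12) (fun _ h => h.swap23) ?_ (.inl .refl) T
  rintro T (h | ⟨k, h⟩)
  · exact .inr ⟨0, .first h⟩
  · by_cases hk : k = 0
    · subst hk; exact h.connected_flipAt
    · exact .inr ⟨0, .step h hk⟩

end BasicTriple

end Triples

/-! ### Lorentzian linear algebra -/

theorem vol_apply (u v w : V) : vol u v w =
    u 0 * (v 1 * w 2 - v 2 * w 1) - u 1 * (v 0 * w 2 - v 2 * w 0) +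
      u 2 * (v 0 * w 1 - v 1 * w 0) := by
  rw [vol]
  refine (Matrix.det_fin_three _).trans ?_
  simp only [Matrix.cons_val_zero, Matrix.cons_val_one, Matrix.cons_val]
  ring

theorem lor_comm (v w : V) : lor v w = lor w v := by simp only [lor]; ring

theorem lor_add_left (u v w : V) : lor (u + v) w = lor u w + lor v w := by
  simp only [lor, Pi.add_apply]; ring

theorem lor_add_right (u v w : V) : lor w (u + v) = lor w u + lor w v := by
  simp only [lor, Pi.add_apply]; ring

theorem lor_sub_left (u v w : V) : lor (u - v) w = lor u w - lor v w := by
  simp only [lor, Pi.sub_apply]; ring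

theorem lor_sub_right (u v w : V) : lor w (u - v) = lor w u - lor w v := by
  simp only [lor, Pi.sub_apply]; ring

theorem lor_neg_left (u w : V) : lor (-u) w = -lor u w := by
  simp only [lor, Pi.neg_apply]; ring

theorem lor_neg_right (u w : V) : lor w (-u) = -lor w u := by
  simp only [lor, Pi.neg_apply]; ring

theorem lor_smul_left (c : ℝ) (u w : V) : lor (c • u) w = c * lor u w := by
  simp only [lor, Pi.smul_apply, smul_eq_mul]; ring

theorem lor_smul_right (c : ℝ) (u w : V) : lor w (c • u) = c * lor w u := by
  simp only [lor, Pi.smul_apply, smul_eq_mul]; ring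

theorem ext_lor {u v : V} (h : ∀ w, lor u w = lor v w) : u = v := by
  ext i
  fin_cases i
  · simpa [lor] using h ![1, 0, 0]
  · simpa [lor] using h ![0, 1, 0]
  · simpa [lor] using h ![0, 0, 1]

/-- The Lorentzian cross product. -/
def lcross (x y : V) : V := ![x 1 * y 2 - x 2 * y 1, x 2 * y 0 - x 0 * y 2, x 1 * y 0 - x 0 * y 1]

theorem lor_lcross (x y v : V) : lor (lcross x y) v = vol x y v := by
  simp only [lor, lcross, vol_apply, Matrix.cons_val_zero, Matrix.cons_val_one, Matrix.cons_val]
  ring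

theorem lor_lcross_lcross (x y : V) :
    lor (lcross x y) (lcross x y) = lor x y ^ 2 - lor x x * lor y y := by
  simp only [lor, lcross, Matrix.cons_val_zero, Matrix.cons_val_one, Matrix.cons_val]
  ring

theorem vol_smul_eq (a b c v : V) :
    vol a b c • v = vol v b c • a + vol a v c • b + vol a b v • c := by
  ext i
  simp only [vol_apply, Pi.smul_apply, Pi.add_apply, smul_eq_mul]
  fin_cases i <;> simp <;> ring

theorem vol_mul_lor (a b v w : V) (s : V) :
    vol a b v * lor s w = vol a b w * lor s v + vol b v w * lor s a - vol a v w * lor s b := by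
  simp only [vol_apply, lor]
  ring

/-- The cross product of two vectors orthogonal to `s` is a multiple of `s`. -/
theorem vol_eq_mul_lor {s a b : V} (hs : lor s s = 1) (ha : lor s a = 0) (hb : lor s b = 0)
    (v : V) : vol a b v = vol a b s * lor s v := by
  have := vol_mul_lor a b v s s
  rw [hs, ha, hb] at this
  linarith

/-- The Gram identity in the plane orthogonal to a unit spacelike vector. -/
theorem vol_mul_vol {s a : V} (hs : lor s s = 1) (ha : lor s a = 0) (b : V)
    {c d : V} (hc : lor s c = 0) (hd : lor s d = 0) :
    vol a b s * vol c d s = lor a d * lor b c - lor a c * lor b d := by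
  have gram : vol a b s * vol c d s = -(lor a c * (lor b d * lor s s - lor b s * lor s d)
      - lor a d * (lor b c * lor s s - lor b s * lor s c)
      + lor a s * (lor b c * lor s d - lor b d * lor s c)) := by
    simp only [vol_apply, lor]; ring
  rw [gram, hs, hc, hd, lor_comm a s, ha]
  ring

theorem mul_add_mul_sq_le (a b c d : ℝ) :
    (a * c + b * d) ^ 2 ≤ (a ^ 2 + b ^ 2) * (c ^ 2 + d ^ 2) := by
  nlinarith [sq_nonneg (a * d - b * c)]

theorem lor_nonpos {u v : V} (hu : lor u u ≤ 0) (hv : lor v v ≤ 0) (hu2 : 0 ≤ u 2)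
    (hv2 : 0 ≤ v 2) : lor u v ≤ 0 := by
  have h1 := mul_add_mul_sq_le (u 0) (u 1) (v 0) (v 1)
  simp only [lor] at *
  have h2 : (u 0 * v 0 + u 1 * v 1) ^ 2 ≤ (u 2 * v 2) ^ 2 := by
    refine h1.trans ?_
    rw [mul_pow]
    exact mul_le_mul (by linarith) (by linarith) (by positivity) (by positivity)
  have := abs_le_of_sq_le_sq' h2 (by positivity)
  linarith [this.2]

theorem lor_neg {u v : V} (hu : lor u u < 0) (hv : lor v v ≤ 0) (hu2 : 0 < u 2)
    (hv2 : 0 < v 2) : lor u v < 0 := by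
  have h1 := mul_add_mul_sq_le (u 0) (u 1) (v 0) (v 1)
  simp only [lor] at *
  have h2 : (u 0 * v 0 + u 1 * v 1) ^ 2 < (u 2 * v 2) ^ 2 := by
    refine h1.trans_lt ?_
    rw [mul_pow]
    have : 0 < v 2 ^ 2 := by positivity
    calc (u 0 ^ 2 + u 1 ^ 2) * (v 0 ^ 2 + v 1 ^ 2) ≤ (u 0 ^ 2 + u 1 ^ 2) * v 2 ^ 2 :=
          mul_le_mul_of_nonneg_left (by linarith) (by positivity)
      _ < u 2 ^ 2 * v 2 ^ 2 := mul_lt_mul_of_pos_right (by linarith) this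
  have := abs_lt_of_sq_lt_sq' h2 (by positivity)
  linarith [this.2]

theorem future_of_lor_neg {u v : V} (hu : lor u u ≤ 0) (hv : lor v v ≤ 0) (hv2 : 0 ≤ v 2)
    (h : lor u v < 0) : 0 < u 2 := by
  by_contra hu2
  have h1 := lor_nonpos (u := -u) (by simpa [lor_neg_left, lor_neg_right] using hu) hv
    (by simpa using hu2) hv2
  rw [lor_neg_left] at h1
  linarith

theorem lor_H2_null {t n : V} (ht : t ∈ H2) (hn : n ∈ FutureNull) : lor t n < 0 :=
  lor_neg (by rw [ht.1]; norm_num) hn.1.le ht.2 hn.2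

theorem pos_of_smul_mem_futureNull {n : V} (hn : n ∈ FutureNull) {c : ℝ}
    (h : c • n ∈ FutureNull) : 0 < c := by
  have := h.2
  simp only [Pi.smul_apply, smul_eq_mul] at this
  exact pos_of_mul_pos_left this hn.2.le

/-- Orthogonal future null vectors are parallel. -/
theorem eq_smul_of_lor_eq_zero {m n : V} (hm : m ∈ FutureNull) (hn : n ∈ FutureNull)
    (h : lor m n = 0) : m = (m 2 / n 2) • n := by
  obtain ⟨hm1, hm2⟩ := hm
  obtain ⟨hn1, hn2⟩ := hn
  simp only [lor] at hm1 hn1 h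
  have key : (m 0 * n 2 - m 2 * n 0) ^ 2 + (m 1 * n 2 - m 2 * n 1) ^ 2 = 0 := by
    linear_combination n 2 ^ 2 * hm1 + m 2 ^ 2 * hn1 - 2 * m 2 * n 2 * h
  have k0 : m 0 * n 2 - m 2 * n 0 = 0 := by nlinarith [sq_nonneg (m 1 * n 2 - m 2 * n 1)]
  have k1 : m 1 * n 2 - m 2 * n 1 = 0 := by nlinarith [sq_nonneg (m 0 * n 2 - m 2 * n 0)]
  ext i
  simp only [Pi.smul_apply, smul_eq_mul]
  fin_cases i <;> simp <;> field_simp <;> linarith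

/-! ### Point symmetries -/

theorem pointInv_apply (t v : V) : pointInv t v = -v - (2 * lor v t) • t := rfl

theorem pointInv_pointInv {t : V} (ht : t ∈ H2) (v : V) : pointInv t (pointInv t v) = v := by
  have h := ht.1
  simp only [pointInv_apply, lor_sub_left, lor_neg_left, lor_smul_left, h]
  module

theorem lor_pointInv_comm (t v w : V) : lor (pointInv t v) w = lor v (pointInv t w) := by
  simp only [pointInv_apply, lor_sub_left, lor_sub_right, lor_neg_left, lor_neg_right,
    lor_smul_left, lor_smul_right, lor_comm w t]
  ring

theorem lor_pointInv {t : V} (ht : t ∈ H2) (v w : V) :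
    lor (pointInv t v) (pointInv t w) = lor v w := by
  rw [lor_pointInv_comm, pointInv_pointInv ht]

theorem pointInv_self {t : V} (ht : t ∈ H2) : pointInv t t = t := by
  rw [pointInv_apply, ht.1]; module

theorem vol_map (X : V →ₗ[ℝ] V) (u v w : V) :
    vol (X u) (X v) (X w) = LinearMap.det X * vol u v w := by
  have h : Matrix.of ![X u, X v, X w] =
      Matrix.of ![u, v, w] * (LinearMap.toMatrix' X).transpose := by
    ext i j
    have hX : ∀ x : V, X x j = ∑ k, x k * (LinearMap.toMatrix' X).transpose k j := by
      intro x
      conv_lhs => rw [← LinearMap.toMatrix'_mulVec X x]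
      simp only [Matrix.mulVec, dotProduct, Matrix.transpose_apply]
      exact Finset.sum_congr rfl fun k _ => mul_comm _ _
    rw [Matrix.mul_apply]
    fin_cases i
    · exact hX u
    · exact hX v
    · exact hX w
  have h2 := congrArg Matrix.det h
  rw [Matrix.det_mul, Matrix.det_transpose, LinearMap.det_toMatrix'] at h2
  rw [mul_comm]
  exact h2

theorem isSO21_pointInv {t : V} (ht : t ∈ H2) : IsSO21 (pointInv t) := by
  refine ⟨lor_pointInv ht, ?_, fun u hu => ⟨by rw [lor_pointInv ht, hu.1], ?_⟩⟩
  · have h := vol_map (pointInv t) ![1, 0, 0] ![0, 1, 0] ![0, 0, 1]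
    have ht1 := ht.1
    simp only [vol_apply, pointInv_apply, lor] at h ht1
    simp at h
    rw [← h]
    linear_combination -2 * ht1
  · refine future_of_lor_neg (v := t) ?_ (by rw [ht.1]; norm_num) ht.2.le ?_
    · rw [lor_pointInv ht, hu.1]; norm_num
    · rw [lor_pointInv_comm, pointInv_self ht]
      exact lor_neg (by rw [hu.1]; norm_num) (by rw [ht.1]; norm_num) hu.2 ht.2

theorem exists_mem_H2 : ∃ t, t ∈ H2 := ⟨![0, 0, 1], by simp [H2, lor]⟩

namespace IsSO21

variable {X : V →ₗ[ℝ] V}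

theorem vol (hX : IsSO21 X) (u v w : V) :
    OneHoledTorus.vol (X u) (X v) (X w) = OneHoledTorus.vol u v w := by
  rw [vol_map, hX.2.1, one_mul]

theorem mem_futureNull (hX : IsSO21 X) {n : V} (hn : n ∈ FutureNull) : X n ∈ FutureNull := by
  obtain ⟨t, ht⟩ := exists_mem_H2
  have hXt := hX.2.2 t ht
  refine ⟨by rw [hX.1, hn.1], future_of_lor_neg (by rw [hX.1, hn.1]) (v := X t)
    (by rw [hXt.1]; norm_num) hXt.2.le ?_⟩
  rw [hX.1, lor_comm]
  exact lor_H2_null ht hn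

theorem pointInv_map (hX : IsSO21 X) (t v : V) :
    pointInv (X t) (X v) = X (pointInv t v) := by
  simp only [pointInv_apply, hX.1, map_sub, map_neg, map_smul]

theorem isOutwardNormal (hX : IsSO21 X) {s x y z : V} (h : IsOutwardNormal s x y z) :
    IsOutwardNormal (X s) (X x) (X y) (X z) := by
  simpa only [IsOutwardNormal, hX.1] using h

end IsSO21

theorem pointInv_conj {t : V} (ht : t ∈ H2) (u v : V) :
    pointInv (pointInv t u) v = pointInv t (pointInv u (pointInv t v)) := by
  rw [← (isSO21_pointInv ht).pointInv_map, pointInv_pointInv ht]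

theorem IsOutwardNormal.symm {s x y z : V} (h : IsOutwardNormal s x y z) :
    IsOutwardNormal s y x z := ⟨h.1, h.2.2.1, h.2.1, h.2.2.2⟩

theorem IsOutwardNormal.smul {s x y z : V} (h : IsOutwardNormal s x y z) {a b c : ℝ}
    (hc : 0 < c) : IsOutwardNormal s (a • x) (b • y) (c • z) := by
  refine ⟨h.1, ?_, ?_, ?_⟩
  · rw [lor_smul_right, h.2.1, mul_zero]
  · rw [lor_smul_right, h.2.2.1, mul_zero]
  · rw [lor_smul_right]; exact mul_neg_of_pos_of_neg hc h.2.2.2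

theorem exists_isOutwardNormal {x y z : V} (hx : lor x x = 0) (hxy : lor x y ≠ 0)
    (hz : vol x y z ≠ 0) : ∃ s, IsOutwardNormal s x y z := by
  have hx' : lor (lcross x y) x = 0 := by rw [lor_lcross, vol_apply]; ring
  have hy' : lor (lcross x y) y = 0 := by rw [lor_lcross, vol_apply]; ring
  have key : ∀ c : ℝ, c ^ 2 = (lor x y ^ 2)⁻¹ → c * vol x y z < 0 →
      IsOutwardNormal (c • lcross x y) x y z := by
    intro c hc hneg
    refine ⟨?_, ?_, ?_, ?_⟩
    · rw [lor_smul_left, lor_smul_right, lor_lcross_lcross, hx, zero_mul, sub_zero, ← mul_assoc,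
        ← sq, hc, inv_mul_cancel₀ (pow_ne_zero 2 hxy)]
    · rw [lor_smul_left, hx', mul_zero]
    · rw [lor_smul_left, hy', mul_zero]
    · rwa [lor_smul_left, lor_lcross]
  have hpos : 0 < |lor x y|⁻¹ := inv_pos.2 (abs_pos.2 hxy)
  rcases lt_or_gt_of_ne hz with h | h
  · exact ⟨_, key |lor x y|⁻¹ (by rw [inv_pow, sq_abs]) (mul_neg_of_pos_of_neg hpos h)⟩
  · refine ⟨_, key (-|lor x y|⁻¹) (by rw [neg_sq, inv_pow, sq_abs]) ?_⟩
    rw [neg_mul, neg_lt_zero]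
    exact mul_pos hpos h

theorem IsOutwardNormal.vol_sq {s x y z : V} (h : IsOutwardNormal s x y z) (hx : lor x x = 0) :
    vol x y s ^ 2 = lor x y ^ 2 := by
  rw [sq, vol_mul_vol h.1 h.2.1 y h.2.1 h.2.2.1, hx, lor_comm y x]
  ring

/-- Unit normals to the plane of `x` and `y` agree up to sign, and `z` decides the sign. -/
theorem IsOutwardNormal.unique {s s' x y z : V} (h : IsOutwardNormal s x y z)
    (h' : IsOutwardNormal s' x y z) (hx : lor x x = 0) (hxy : lor x y ≠ 0) : s = s' := by
  have h1 := vol_eq_mul_lor h.1 h.2.1 h.2.2.1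
  have h2 := vol_eq_mul_lor h'.1 h'.2.1 h'.2.2.1
  have hs : vol x y s ≠ 0 := fun h0 => by
    have := h.vol_sq hx
    rw [h0] at this
    exact hxy (pow_eq_zero_iff two_ne_zero |>.1 (by linarith))
  have heq : vol x y s = vol x y s' := by
    have e : vol x y s ^ 2 = vol x y s' ^ 2 := (h.vol_sq hx).trans (h'.vol_sq hx).symm
    rcases sq_eq_sq_iff_eq_or_eq_neg.1 e with e | e
    · exact e
    · exfalso
      have e1 := h1 z
      rw [h2 z, e] at e1
      have hs' : vol x y s' ≠ 0 := fun h0 => hs (by rw [e, h0, neg_zero])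
      have e2 : lor s' z = -lor s z := mul_left_cancel₀ hs' (by rw [e1]; ring)
      linarith [h.2.2.2, h'.2.2.2]
  refine ext_lor fun w => mul_left_cancel₀ hs ?_
  rw [← h1, heq, ← h2]


/-! ### Ideal triangles over point symmetries and their flips -/

/-- The sum `n + pointInv t n` is a multiple of `t`, positive for future null `n` and `t ∈ H2`: a
point lies on the geodesic between an ideal point and its image. This gives the position of each `t
j` relative to each side. -/
theorem lor_mul_lor_pointInv (s t n : V) :
    lor s t * (-2 * lor n t) = lor s n + lor s (pointInv t n) := by
  rw [pointInv_apply, lor_sub_right, lor_neg_right, lor_smul_right]; ring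

theorem lor_point_neg {s t n : V} (ht : t ∈ H2) (hn : n ∈ FutureNull)
    (h : lor s n + lor s (pointInv t n) < 0) : lor s t < 0 := by
  rw [← lor_mul_lor_pointInv] at h
  have := lor_H2_null ht hn
  rw [lor_comm] at this
  exact neg_of_mul_neg_left h (by linarith)

theorem lor_point_eq_zero {s t n : V} (ht : t ∈ H2) (hn : n ∈ FutureNull)
    (h : lor s n + lor s (pointInv t n) = 0) : lor s t = 0 := by
  rw [← lor_mul_lor_pointInv] at h
  have := lor_H2_null ht hn
  rw [lor_comm] at this
  exact (mul_eq_zero.1 h).resolve_right (by linarith)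

/-- The points `t` of the hyperbolic plane and the ideal triangle with vertex `n` and outward
normals `s`. -/
structure IsTriangle (t : Fin 3 → V) (n : V) (s : Fin 3 → V) : Prop where
  mem : ∀ i, t i ∈ H2
  tri : IsIdealTriangle t n s

namespace IsTriangle

variable {t : Fin 3 → V} {n : V} {s : Fin 3 → V}

theorem vertex (h : IsTriangle t n s) : n ∈ FutureNull := h.tri.1

theorem vertex_image (h : IsTriangle t n s) (i : Fin 3) : pointInv (t i) n ∈ FutureNull :=
  (isSO21_pointInv (h.mem i)).mem_futureNull h.vertex

theorem exists_pos (h : IsTriangle t n s) : ∃ c : ℝ, 0 < c ∧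
    pointInv (t 0) (pointInv (t 1) (pointInv (t 2) n)) = c • n := by
  obtain ⟨c, hc⟩ := h.tri.2.1
  refine ⟨c, pos_of_smul_mem_futureNull h.vertex ?_, hc⟩
  rw [← hc]
  exact (isSO21_pointInv (h.mem 0)).mem_futureNull
    ((isSO21_pointInv (h.mem 1)).mem_futureNull (h.vertex_image 2))

theorem exists_pos_one (h : IsTriangle t n s) : ∃ c : ℝ, 0 < c ∧
    pointInv (t 1) (pointInv (t 0) n) = c • pointInv (t 2) n := by
  obtain ⟨c, hc, h1⟩ := h.exists_pos
  refine ⟨c⁻¹, inv_pos.2 hc, ?_⟩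
  have h2 := congrArg (fun v => pointInv (t 1) (pointInv (t 0) v)) h1
  simp only [pointInv_pointInv (h.mem _), map_smul] at h2
  rw [h2, smul_smul, inv_mul_cancel₀ hc.ne', one_smul]

theorem lor_self (h : IsTriangle t n s) (i : Fin 3) : lor (s i) (t i) = 0 := by
  obtain ⟨c, hc, h1⟩ := h.exists_pos_one
  obtain ⟨hn, -, h0, h1', h2⟩ := h.tri
  fin_cases i
  · exact lor_point_eq_zero (h.mem 0) hn (by simp [h0.2.1, h0.2.2.1])
  · refine lor_point_eq_zero (h.mem 1) (h.vertex_image 0) ?_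
    simp [h1, lor_smul_right, h1'.2.1, h1'.2.2.1]
  · exact lor_point_eq_zero (h.mem 2) hn (by simp [h2.2.1, h2.2.2.1])

theorem lor_neg (h : IsTriangle t n s) {i j : Fin 3} (hij : i ≠ j) : lor (s i) (t j) < 0 := by
  obtain ⟨c, hc, h1⟩ := h.exists_pos_one
  obtain ⟨hn, -, h0, h1', h2⟩ := h.tri
  have p0 := lor_point_neg (s := s i) (h.mem 0) hn
  have p1 := lor_point_neg (s := s i) (h.mem 1) (h.vertex_image 0)
  have p2 := lor_point_neg (s := s i) (h.mem 2) hn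
  rw [h1, lor_smul_right] at p1
  fin_cases i <;> fin_cases j <;> simp_all [IsOutwardNormal, mul_neg_of_pos_of_neg]

theorem lor_vertices_ne_zero (h : IsTriangle t n s) : lor n (pointInv (t 0) n) ≠ 0 := by
  intro h0
  have h1 := eq_smul_of_lor_eq_zero h.vertex (h.vertex_image 0) h0
  have h2 := h.tri.2.2.2.1
  have h3 := h2.2.2.2
  rw [h1, lor_smul_right, h2.2.1, mul_zero] at h3
  exact lt_irrefl _ h3

theorem vol_vertices_ne_zero (h : IsTriangle t n s) :
    vol n (pointInv (t 0) n) (pointInv (t 2) n) ≠ 0 := by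
  have h0 := h.tri.2.2.1
  rw [vol_eq_mul_lor h0.1 h0.2.1 h0.2.2.1]
  refine mul_ne_zero (fun h1 => h.lor_vertices_ne_zero ?_) h0.2.2.2.ne
  have := h0.vol_sq h.vertex.1
  rw [h1] at this
  exact pow_eq_zero_iff two_ne_zero |>.1 (by linarith)

theorem vol_points_ne_zero (h : IsTriangle t n s) : vol (t 0) (t 1) (t 2) ≠ 0 := by
  obtain ⟨c, hc, h1⟩ := h.exists_pos_one
  have h2 := h.vol_vertices_ne_zero
  intro h0
  have e0 : pointInv (t 0) n = -n - (2 * lor n (t 0)) • t 0 := rfl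
  have e2 : pointInv (t 2) n = -n - (2 * lor n (t 2)) • t 2 := rfl
  have e1 : pointInv (t 1) (pointInv (t 0) n) =
    -pointInv (t 0) n - (2 * lor (pointInv (t 0) n) (t 1)) • t 1 := rfl
  rw [h1] at e1
  set m := pointInv (t 0) n
  set k := pointInv (t 2) n
  -- Up to scalars the three points are `n + m`, `m + c • k` and `n + k`, whose coefficient
  -- determinant is `1 + c`.
  have key : (2 * lor n (t 0)) * (2 * lor m (t 1)) * (2 * lor n (t 2)) * vol (t 0) (t 1) (t 2) =
      -(1 + c) * vol n m k := by
    have f0 : (2 * lor n (t 0)) • t 0 = -n - m := by rw [e0]; module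
    have f2 : (2 * lor n (t 2)) • t 2 = -n - k := by rw [e2]; module
    have f1 : (2 * lor m (t 1)) • t 1 = -m - c • k := by rw [e1]; module
    have e : ∀ (a b d : ℝ) (x y z : V), a * b * d * vol x y z = vol (a • x) (b • y) (d • z) := by
      intro a b d x y z
      simp only [vol_apply, Pi.smul_apply, smul_eq_mul]; ring
    rw [e, f0, f1, f2]
    simp only [vol_apply, Pi.smul_apply, Pi.sub_apply, Pi.neg_apply, smul_eq_mul]; ring
  rw [h0, mul_zero] at key
  have : -(1 + c) ≠ 0 := by linarith
  exact mul_ne_zero this h2 key.symm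

theorem map (h : IsTriangle t n s) {X : V →ₗ[ℝ] V} (hX : IsSO21 X) :
    IsTriangle (fun i => X (t i)) (X n) (fun i => X (s i)) := by
  refine ⟨fun i => hX.2.2 _ (h.mem i), hX.mem_futureNull h.vertex, ?_⟩
  simp only [hX.pointInv_map]
  obtain ⟨-, ⟨c, hc⟩, h0, h1, h2⟩ := h.tri
  exact ⟨⟨c, by rw [hc, map_smul]⟩, hX.isOutwardNormal h0, hX.isOutwardNormal h1,
    hX.isOutwardNormal h2⟩

theorem swap12 (h : IsTriangle t n s) :
    IsTriangle ![t 0, t 2, t 1] (pointInv (t 0) n) ![s 0, s 2, s 1] := by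
  obtain ⟨c, hc, hc'⟩ := h.exists_pos_one
  obtain ⟨hn, -, h0, h1, h2⟩ := h.tri
  refine ⟨fun i => by fin_cases i <;> exact h.mem _, h.vertex_image 0, ⟨c, ?_⟩, ?_, ?_, ?_⟩
  · simp [hc', pointInv_pointInv (h.mem _)]
  · simpa [hc', pointInv_pointInv (h.mem _)] using h0.symm.smul (a := 1) (b := 1) hc
  · simpa [hc', pointInv_pointInv (h.mem _)] using h2.symm.smul (a := 1) (b := c) one_pos
  · simpa [hc', pointInv_pointInv (h.mem _)] using h1.symm.smul (a := c) (b := 1) one_pos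

theorem swap23 (h : IsTriangle t n s) :
    IsTriangle ![t 2, t 1, t 0] n ![s 2, s 1, s 0] := by
  obtain ⟨c, hc, hc'⟩ := h.exists_pos_one
  obtain ⟨hn, -, h0, h1, h2⟩ := h.tri
  refine ⟨fun i => by fin_cases i <;> exact h.mem _, hn, ⟨c, ?_⟩, ?_, ?_, ?_⟩
  · simp [hc', pointInv_pointInv (h.mem _)]
  · exact h2.symm
  · exact h1.symm
  · exact h0.symm

/-- The triangle `n, m, k` and its image under the symmetry in `t 0` form the quadrilateral `n, k,
m, k'`. The diagonal from `n` to `m` gives way to the one from `k'` to `k`. The new triangle `k', k,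
m` keeps the side of `s 1` and takes over the image of the side of `s 2`. -/
theorem flip (h : IsTriangle t n s) : ∃ s₀,
    IsTriangle ![t 0, t 1, pointInv (t 0) (t 2)] (pointInv (t 0) (pointInv (t 2) n))
      ![s₀, s 1, pointInv (t 0) (s 2)] := by
  obtain ⟨c, hc, hc'⟩ := h.exists_pos_one
  have hv := h.vol_vertices_ne_zero
  have hm := h.lor_neg (i := 1) (j := 0) (by decide)
  have hm2 := h.lor_neg (i := 2) (j := 0) (by decide)
  obtain ⟨hn, -, h0, h1, h2⟩ := h.tri
  have hX := isSO21_pointInv (h.mem 0)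
  set m := pointInv (t 0) n with hmdef
  set k := pointInv (t 2) n with hkdef
  have hk : k ∈ FutureNull := h.vertex_image 2
  have hm' : m ∈ FutureNull := h.vertex_image 0
  set k' := pointInv (t 0) k with hk'def
  have hk'k : pointInv (t 0) k' = k := pointInv_pointInv (h.mem 0) k
  have e2 : pointInv (pointInv (t 0) (t 2)) k' = m := by
    rw [pointInv_conj (h.mem 0), hk'k, hkdef, pointInv_pointInv (h.mem 2)]
  have hkt := lor_H2_null (h.mem 0) hk
  have hnt := lor_H2_null (h.mem 0) hn
  rw [lor_comm] at hkt hnt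
  have ek : k' = -k - (2 * lor k (t 0)) • t 0 := rfl
  have em : m = -n - (2 * lor n (t 0)) • t 0 := rfl
  have hvol : vol k' k m ≠ 0 := by
    have key : lor n (t 0) * vol k' k m = - lor k (t 0) * vol n m k := by
      rw [ek, em]
      simp only [vol_apply, Pi.smul_apply, Pi.sub_apply, Pi.neg_apply, smul_eq_mul]; ring
    intro h0
    rw [h0, mul_zero] at key
    exact mul_ne_zero (by linarith) hv key.symm
  have hlor : lor k' k ≠ 0 := by
    intro h0
    have h3 := eq_smul_of_lor_eq_zero (hX.mem_futureNull hk) hk h0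
    rw [← hk'def] at h3
    apply hvol
    rw [h3]
    simp only [vol_apply, Pi.smul_apply, smul_eq_mul]; ring
  obtain ⟨s₀, hs₀⟩ := exists_isOutwardNormal (z := m) (hX.mem_futureNull hk).1 hlor hvol
  have hs1 : lor (s 1) k' < 0 := by
    rw [ek, lor_sub_right, lor_neg_right, lor_smul_right, h1.2.2.1]
    nlinarith
  have hs2 : lor (s 2) k' < 0 := by
    rw [ek, lor_sub_right, lor_neg_right, lor_smul_right, h2.2.1]
    nlinarith
  refine ⟨s₀, fun i => by fin_cases i <;> [exact h.mem 0; exact h.mem 1; exact hX.2.2 _ (h.mem 2)],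
    hX.mem_futureNull hk, ⟨c, ?_⟩, ?_, ?_, ?_⟩
  · simp only [Matrix.cons_val_zero, Matrix.cons_val_one, Matrix.cons_val, e2, hc', map_smul]
    rfl
  · simpa [e2, hk'k] using hs₀
  · simpa [e2, hk'k] using (show IsOutwardNormal (s 1) k m k' from ⟨h1.1, h1.2.2.1, h1.2.1, hs1⟩)
  · simp only [Matrix.cons_val_zero, Matrix.cons_val, e2, hk'k]
    refine ⟨by rw [hX.1, h2.1], ?_, ?_, ?_⟩
    · rw [lor_pointInv_comm, hmdef, pointInv_pointInv (h.mem 0), h2.2.2.1]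
    · rw [hX.1, h2.2.1]
    · rwa [lor_pointInv_comm]

end IsTriangle

/-! ### Particles and strip coordinates -/

theorem particleInv_apply (t p x : V) : particleInv t p x = p + pointInv t (x - p) := rfl

theorem particleInv_particleInv {t : V} (ht : t ∈ H2) (p x : V) :
    particleInv t p (particleInv t p x) = x := by
  simp only [particleInv_apply, add_sub_cancel_left, pointInv_pointInv ht, add_sub_cancel]

/-- Transport of particle involutions under an affine isometry. -/
theorem particleInv_map {X : V →ₗ[ℝ] V} (hX : IsSO21 X) (b t p x : V) :
    particleInv (X t) (X p + b) (X x + b) = X (particleInv t p x) + b := by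
  have e : X x + b - (X p + b) = X (x - p) := by rw [map_sub]; abel
  rw [particleInv_apply, particleInv_apply, e, hX.pointInv_map, map_add]; abel

/-- The involution in the image of a particle under another particle involution. -/
theorem particleInv_conj {t : V} (ht : t ∈ H2) (p u q x : V) :
    particleInv (pointInv t u) (particleInv t p q) x =
      particleInv t p (particleInv u q (particleInv t p x)) := by
  have e : ∀ y, particleInv t p y = pointInv t y + (p - pointInv t p) := fun y => by
    rw [particleInv_apply, map_sub]; abel
  have h := particleInv_map (isSO21_pointInv ht) (p - pointInv t p) u q (particleInv t p x)
  rwa [← e, ← e, ← e, particleInv_particleInv ht] at h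

/-- The derivative of `-2 * lor (t i) (t j)` along the deformation given by the particles. -/
def dtrace (t p : Fin 3 → V) (i j : Fin 3) : ℝ := -2 * vol (t i) (t j) (p i - p j)

/-- `l` are the strip coordinates of the deformation given by the particles. -/
def IsStripCoord (t s p : Fin 3 → V) (l : Fin 3 → ℝ) : Prop :=
  ∀ i j, i ≠ j → dtrace t p i j = l i * (-2 * lor (s i) (t j)) + l j * (-2 * lor (s j) (t i))

theorem dtrace_comm (t p : Fin 3 → V) (i j : Fin 3) : dtrace t p i j = dtrace t p j i := by
  simp only [dtrace, vol_apply, Pi.sub_apply]; ring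

theorem IsStripCoord.unique {t s p : Fin 3 → V} {l l' : Fin 3 → ℝ}
    (hneg : ∀ i j, i ≠ j → lor (s i) (t j) < 0) (h : IsStripCoord t s p l)
    (h' : IsStripCoord t s p l') : l = l' := by
  have e : ∀ i j, i ≠ j → (l i - l' i) * lor (s i) (t j) = -((l j - l' j) * lor (s j) (t i)) :=
    fun i j hij => by linarith [h i j hij, h' i j hij]
  have key : ∀ i j k, i ≠ j → j ≠ k → i ≠ k → l i = l' i := by
    intro i j k hij hjk hik
    have e1 := e i j hij
    have e2 := e j k hjk
    have e3 := e i k hik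
    have n1 := hneg i j hij
    have n2 := hneg j i hij.symm
    have n3 := hneg j k hjk
    have n4 := hneg k j hjk.symm
    have n5 := hneg i k hik
    have n6 := hneg k i hik.symm
    -- The second factor is, up to a constant, the determinant of the linear system; both of its
    -- products are negative, so it cannot vanish.
    have hz : (l i - l' i) * (lor (s i) (t j) * lor (s j) (t k) * lor (s k) (t i) +
        lor (s i) (t k) * lor (s k) (t j) * lor (s j) (t i)) = 0 := by
      linear_combination lor (s j) (t k) * lor (s k) (t i) * e1 -
        lor (s j) (t i) * lor (s k) (t i) * e2 +
        lor (s k) (t j) * lor (s j) (t i) * e3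
    have hm1 := mul_neg_of_pos_of_neg (mul_pos_of_neg_of_neg n1 n3) n6
    have hm2 := mul_neg_of_pos_of_neg (mul_pos_of_neg_of_neg n5 n4) n2
    have := (mul_eq_zero.1 hz).resolve_right (by linarith)
    linarith
  funext i
  fin_cases i
  · exact key 0 1 2 (by decide) (by decide) (by decide)
  · exact key 1 0 2 (by decide) (by decide) (by decide)
  · exact key 2 0 1 (by decide) (by decide) (by decide)

/-- The deformations given by translations in the directions of crooked halfspaces have positive
strip coordinates. -/
theorem exists_isStripCoord_of_transSemigroup {t s : Fin 3 → V} (O : V) {q : Fin 3 → V}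
    (ht : ∀ i, t i ∈ H2) (hs : ∀ i, lor (s i) (s i) = 1) (hst : ∀ i, lor (s i) (t i) = 0)
    (hq : ∀ i, q i ∈ transSemigroup (s i)) :
    ∃ l : Fin 3 → ℝ, (∀ i, 0 < l i) ∧ IsStripCoord t s (fun i => O + q i) l := by
  -- In the plane orthogonal to `s i`, the timelike `t i` lies between the two null rays, so the two
  -- terms of `q i` contribute with the same sign.
  have hl : ∀ i, vol (t i) (q i) (s i) < 0 ∧ lor (s i) (q i) = 0 := by
    intro i
    obtain ⟨m, hm, p, hp, hsm, hsp, hv, a, b, ha, hb, hqi⟩ := hq i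
    have g1 := vol_mul_vol (hs i) (hst i) p hsm hsp
    have g2 := vol_mul_vol (hs i) (hst i) m hsm hsp
    have g3 := vol_mul_vol (hs i) hsm p hsm hsp
    rw [hp.1, lor_comm p m] at g1
    rw [hm.1] at g2
    rw [hm.1, lor_comm p m] at g3
    have n1 := lor_H2_null (ht i) hm
    have n2 := lor_H2_null (ht i) hp
    have n3 : lor m p < 0 := by
      refine lt_of_le_of_ne (lor_nonpos hm.1.le hp.1.le hm.2.le hp.2.le) fun h0 => ?_
      rw [h0] at g3
      have := mul_pos hv hv
      linarith
    have v1 : 0 < vol (t i) p (s i) := by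
      refine pos_of_mul_pos_left (b := vol m p (s i)) ?_ hv.le
      rw [g1]; nlinarith
    have v2 : vol (t i) m (s i) < 0 := by
      refine neg_of_mul_neg_left (b := vol m p (s i)) ?_ hv.le
      rw [g2]; nlinarith
    refine ⟨?_, by rw [hqi, lor_sub_right, lor_smul_right, lor_smul_right, hsm, hsp]; ring⟩
    have : vol (t i) (q i) (s i) = a * vol (t i) m (s i) - b * vol (t i) p (s i) := by
      rw [hqi]; simp only [vol_apply, Pi.smul_apply, Pi.sub_apply, smul_eq_mul]; ring
    rw [this]
    nlinarith
  -- Both `t i` and `q i` are orthogonal to `s i`, so `vol (t i) (q i) _` is this coordinate times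
  -- `-lor (s i) _`; the common translation `O` drops out.
  refine ⟨fun i => -vol (t i) (q i) (s i), fun i => by linarith [(hl i).1], fun i j _ => ?_⟩
  have e1 := vol_eq_mul_lor (hs i) (hst i) (hl i).2 (t j)
  have e2 := vol_eq_mul_lor (hs j) (hst j) (hl j).2 (t i)
  have e3 : vol (t i) (t j) (O + q i - (O + q j)) =
      -vol (t i) (q i) (t j) - vol (t j) (q j) (t i) := by
    simp only [vol_apply, Pi.sub_apply, Pi.add_apply]; ring
  rw [dtrace, e3, e1, e2]
  ring

/-- Positivity of strip coordinates and of length derivatives is kept by a flip except for the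
coordinate of the flipped arc. -/
theorem flip_strip_coord {x01 x02 a01 a02 a10 a12 a20 a21 b01 b02 b12 b21 d01 d02 d12 l0 l1 l2 : ℝ}
    (hb01 : 0 < b01) (hb02 : 0 < b02) (ha10 : 0 < a10) (ha20 : 0 < a20)
    (ha01 : 0 < a01) (ha02 : 0 < a02) (ha12 : 0 < a12) (ha21 : 0 < a21)
    (hb12 : 0 < b12) (hb21 : 0 < b21)
    (e12 : b12 = x02 * a10 - a12) (e21 : b21 = x01 * a20 - a21)
    (hd01 : 0 < d01) (hd02 : 0 < d02) (hl0 : 0 < l0)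
    (h01 : d01 = l0 * a01 + l1 * a10) (h02 : d02 = l0 * a02 + l2 * a20)
    (h12 : d12 = l1 * a12 + l2 * a21) :
    ∃ m0 m1 m2 : ℝ, m0 < 0 ∧ 0 < m1 ∧ 0 < m2 ∧ 0 < x01 * d02 + x02 * d01 - d12 ∧
      d01 = m0 * b01 + m1 * a10 ∧ d02 = m0 * b02 + m2 * a20 ∧
      x01 * d02 + x02 * d01 - d12 = m1 * b12 + m2 * b21 := by
  -- Solve the first two equations for `m1` and `m2` and insert them in the third. With `e12` and
  -- `e21` everything cancels except `m0 * L = -(l0 * K)`, which fixes the sign of `m0`.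
  set K := a01 * a12 / a10 + a02 * a21 / a20 with hK
  set L := b01 * b12 / a10 + b02 * b21 / a20 with hL
  have hK0 : 0 < K := by positivity
  have hL0 : 0 < L := by positivity
  have hm0 : -(l0 * K / L) < 0 := neg_lt_zero.2 (by positivity)
  have hm1 : 0 < (d01 - -(l0 * K / L) * b01) / a10 := div_pos (by nlinarith) ha10
  have hm2 : 0 < (d02 - -(l0 * K / L) * b02) / a20 := div_pos (by nlinarith) ha20
  have key : x01 * d02 + x02 * d01 - d12 = (d01 - -(l0 * K / L) * b01) / a10 * b12 +
      (d02 - -(l0 * K / L) * b02) / a20 * b21 := by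
    have e1 : (d01 - -(l0 * K / L) * b01) / a10 * b12 +
      (d02 - -(l0 * K / L) * b02) / a20 * b21 = d01 / a10 * b12 + d02 / a20 * b21 +
        l0 * K / L * L := by rw [hL]; ring
    rw [e1, div_mul_cancel₀ _ hL0.ne', hK, h12, e12, e21]
    have f1 : l1 = (d01 - l0 * a01) / a10 := by rw [h01]; field_simp; ring
    have f2 : l2 = (d02 - l0 * a02) / a20 := by rw [h02]; field_simp; ring
    rw [f1, f2]
    field_simp
    ring
  refine ⟨-(l0 * K / L), _, _, hm0, hm1, hm2, ?_, ?_, ?_, key⟩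
  · rw [key]; positivity
  · field_simp; ring
  · field_simp; ring


/-! ### Actions realized by involutions -/

/-- `a` is an action of the free group on a set. -/
structure IsAction {S : Type*} (a : F2 → S → S) : Prop where
  one : ∀ x, a 1 x = x
  mul : ∀ g h x, a (g * h) x = a g (a h x)

/-- The action `a` restricts the action of the group generated by the involutions `j`. -/
def Realizes {S : Type*} (a : F2 → S → S) (T : BasicTriple) (j : Fin 3 → S → S) : Prop :=
  ∀ x, a T.A x = j 2 (j 0 x) ∧ a T.B x = j 0 (j 1 x) ∧ a T.C x = j 1 (j 2 x)

section Realizes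

variable {S : Type*} {a : F2 → S → S} {T : BasicTriple} {j : Fin 3 → S → S}

theorem IsAction.inv (ha : IsAction a) {g : F2} {f f' : S → S} (h : ∀ x, a g x = f x)
    (hf : ∀ x, f (f' x) = x) (x : S) : a g⁻¹ x = f' x := by
  conv_lhs => rw [← hf x, ← h, ← ha.mul, inv_mul_cancel, ha.one]

theorem Realizes.of_AB (ha : IsAction a) (hj : ∀ i x, j i (j i x) = x)
    (hA : ∀ x, a T.A x = j 2 (j 0 x)) (hB : ∀ x, a T.B x = j 0 (j 1 x)) : Realizes a T j := by
  refine fun x => ⟨hA x, hB x, ?_⟩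
  rw [T.C_eq]
  refine ha.inv (f := fun x => j 2 (j 1 x)) (f' := fun x => j 1 (j 2 x)) (fun x => ?_)
    (fun x => ?_) x
  · rw [ha.mul, hB, hA, hj]
  · simp only [hj]

theorem Realizes.swap12 (ha : IsAction a) (hj : ∀ i x, j i (j i x) = x) (h : Realizes a T j) :
    Realizes a T.swap12 ![j 0, j 2, j 1] := by
  refine .of_AB ha (fun i x => by fin_cases i <;> exact hj _ x) ?_ ?_
  · exact ha.inv (fun x => (h x).2.1) fun x => by simp [hj]
  · exact ha.inv (fun x => (h x).1) fun x => by simp [hj]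

theorem Realizes.swap23 (ha : IsAction a) (hj : ∀ i x, j i (j i x) = x) (h : Realizes a T j) :
    Realizes a T.swap23 ![j 2, j 1, j 0] := by
  refine .of_AB ha (fun i x => by fin_cases i <;> exact hj _ x) ?_ ?_
  · exact ha.inv (fun x => (h x).1) fun x => by simp [hj]
  · exact ha.inv (fun x => (h x).2.2) fun x => by simp [hj]

theorem Realizes.flip (ha : IsAction a) (hj : ∀ i x, j i (j i x) = x) (h : Realizes a T j) :
    Realizes a T.flip ![j 0, j 1, fun x => j 0 (j 2 (j 0 x))] := by
  refine .of_AB ha (fun i x => by fin_cases i <;> simp [hj]) ?_ ?_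
  · exact ha.inv (fun x => (h x).1) fun x => by simp [hj]
  · exact fun x => (h x).2.1

theorem Realizes.eps (ha : IsAction a) (hj : ∀ i x, j i (j i x) = x) (h : Realizes a T j) :
    Realizes a T.eps (fun i x => j 0 (j i (j 0 x))) := by
  refine .of_AB ha (fun i x => by simp [hj]) ?_ ?_
  · exact ha.inv (fun x => (h x).1) fun x => by simp [hj]
  · exact ha.inv (fun x => (h x).2.1) fun x => by simp [hj]

theorem Realizes.conj (ha : IsAction a) (h : Realizes a T j) (g : F2) :
    Realizes a (T.conj g) (fun i x => a g (j i (a g⁻¹ x))) := by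
  have hg : ∀ x, a g⁻¹ (a g x) = x := fun x => by rw [← ha.mul, inv_mul_cancel, ha.one]
  intro x
  simp only [hg, BasicTriple.conj, BasicTriple.map, MulAut.conj_apply, ha.mul]
  exact ⟨by rw [(h _).1], by rw [(h _).2.1], by rw [(h _).2.2]⟩

end Realizes

/-! ### Crooked configurations -/

/-- `u` is a cocycle. -/
def IsCocycle (ρ₀ : Representation ℝ F2 V) (u : F2 → V) : Prop :=
  ∀ g h, u (g * h) = ρ₀ g (u h) + u g

section Config

variable {ρ₀ : Representation ℝ F2 V} {n₀ : V} {u : F2 → V}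

theorem isAction_linear (ρ₀ : Representation ℝ F2 V) : IsAction fun g x => ρ₀ g x :=
  ⟨fun x => by simp, fun g h x => by simp⟩

theorem IsCocycle.isAction (hu : IsCocycle ρ₀ u) : IsAction fun g x => ρ₀ g x + u g := by
  refine ⟨fun x => ?_, fun g h x => ?_⟩
  · have := hu 1 1
    simp only [mul_one, map_one, Module.End.one_apply, left_eq_add] at this
    simp [this]
  · simp only [hu g h, map_mul, Module.End.mul_apply, map_add]; abel

theorem SameOrbit.smul_map {m n n' : V} (h : SameOrbit ρ₀ m n) (g : F2) {c : ℝ} (hc : 0 < c)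
    (hn' : n' = c • ρ₀ g n) : SameOrbit ρ₀ m n' := by
  obtain ⟨g', c', hc', rfl⟩ := h
  refine ⟨g * g', c * c', mul_pos hc hc', ?_⟩
  rw [hn', map_smul, smul_smul, map_mul, Module.End.mul_apply]

/-- Points `t`, an ideal triangle with vertex `n` and normals `s`, and base points `p` of particles
which realize the affine deformation `u` of `ρ₀` with respect to the basic triple `T`. -/
structure IsConfig (ρ₀ : Representation ℝ F2 V) (n₀ : V) (u : F2 → V) (T : BasicTriple)
    (t : Fin 3 → V) (n : V) (s p : Fin 3 → V) : Prop where
  tri : IsTriangle t n s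
  lin : Realizes (fun g x => ρ₀ g x) T (fun i => pointInv (t i))
  orb : SameOrbit ρ₀ n₀ n
  aff : Realizes (fun g x => ρ₀ g x + u g) T (fun i => particleInv (t i) (p i))

namespace IsConfig

variable {T : BasicTriple} {t : Fin 3 → V} {n : V} {s p : Fin 3 → V}

theorem lin_inv (h : IsConfig ρ₀ n₀ u T t n s p) (i : Fin 3) (x : V) :
    pointInv (t i) (pointInv (t i) x) = x := pointInv_pointInv (h.tri.mem i) x

theorem aff_inv (h : IsConfig ρ₀ n₀ u T t n s p) (i : Fin 3) (x : V) :
    particleInv (t i) (p i) (particleInv (t i) (p i) x) = x :=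
  particleInv_particleInv (h.tri.mem i) _ x

/-- The symmetry in `t 0` need not come from the free group, but its value at `n` does up to scale:
`C` acts as `ι₁ι₂`, and `ι₀ι₁ι₂` fixes `[n]`. -/
theorem sameOrbit_image (h : IsConfig ρ₀ n₀ u T t n s p) :
    SameOrbit ρ₀ n₀ (pointInv (t 0) n) := by
  obtain ⟨c, hc, h1⟩ := h.tri.exists_pos
  refine h.orb.smul_map T.C (inv_pos.2 hc) ?_
  have h2 := congrArg (pointInv (t 0)) h1
  rw [h.lin_inv, map_smul] at h2
  have h3 : ρ₀ T.C n = pointInv (t 1) (pointInv (t 2) n) := (h.lin n).2.2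
  rw [h3, h2, smul_smul, inv_mul_cancel₀ hc.ne', one_smul]

theorem swap12 (hu : IsCocycle ρ₀ u) (h : IsConfig ρ₀ n₀ u T t n s p) :
    IsConfig ρ₀ n₀ u T.swap12 ![t 0, t 2, t 1] (pointInv (t 0) n) ![s 0, s 2, s 1]
      ![p 0, p 2, p 1] := by
  refine ⟨h.tri.swap12, ?_, h.sameOrbit_image, ?_⟩
  · exact h.lin.swap12 (isAction_linear ρ₀) h.lin_inv
  · exact h.aff.swap12 hu.isAction h.aff_inv

theorem swap23 (hu : IsCocycle ρ₀ u) (h : IsConfig ρ₀ n₀ u T t n s p) :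
    IsConfig ρ₀ n₀ u T.swap23 ![t 2, t 1, t 0] n ![s 2, s 1, s 0] ![p 2, p 1, p 0] := by
  refine ⟨h.tri.swap23, ?_, h.orb, ?_⟩
  · exact h.lin.swap23 (isAction_linear ρ₀) h.lin_inv
  · exact h.aff.swap23 hu.isAction h.aff_inv

theorem eps (hu : IsCocycle ρ₀ u) (h : IsConfig ρ₀ n₀ u T t n s p) :
    IsConfig ρ₀ n₀ u T.eps (fun i => pointInv (t 0) (t i)) (pointInv (t 0) n)
      (fun i => pointInv (t 0) (s i)) (fun i => particleInv (t 0) (p 0) (p i)) := by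
  refine ⟨h.tri.map (isSO21_pointInv (h.tri.mem 0)), ?_, h.sameOrbit_image, ?_⟩
  · have e : (fun i (x : V) => pointInv (pointInv (t 0) (t i)) x) =
        fun i x => pointInv (t 0) (pointInv (t i) (pointInv (t 0) x)) :=
      funext fun i => funext fun x => pointInv_conj (h.tri.mem 0) _ _
    rw [e]
    exact h.lin.eps (isAction_linear ρ₀) h.lin_inv
  · have e : (fun i => particleInv (pointInv (t 0) (t i)) (particleInv (t 0) (p 0) (p i))) =
        fun i x => particleInv (t 0) (p 0) (particleInv (t i) (p i)
          (particleInv (t 0) (p 0) x)) :=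
      funext fun i => funext fun x => particleInv_conj (h.tri.mem 0) _ _ _ _
    rw [e]
    exact h.aff.eps hu.isAction h.aff_inv

theorem conj (hρ : ∀ g, IsSO21 (ρ₀ g)) (hu : IsCocycle ρ₀ u) (h : IsConfig ρ₀ n₀ u T t n s p)
    (g : F2) : IsConfig ρ₀ n₀ u (T.conj g) (fun i => ρ₀ g (t i)) (ρ₀ g n)
      (fun i => ρ₀ g (s i)) (fun i => ρ₀ g (p i) + u g) := by
  refine ⟨h.tri.map (hρ g), ?_, h.orb.smul_map g one_pos (one_smul _ _).symm, ?_⟩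
  · have e : (fun i (x : V) => pointInv (ρ₀ g (t i)) x) =
        fun i x => ρ₀ g (pointInv (t i) (ρ₀ g⁻¹ x)) := by
      funext i x
      rw [← (hρ g).pointInv_map]
      simp
    rw [e]
    exact h.lin.conj (isAction_linear ρ₀) g
  · have e : (fun i => particleInv (ρ₀ g (t i)) (ρ₀ g (p i) + u g)) =
        fun i x => ρ₀ g (particleInv (t i) (p i) (ρ₀ g⁻¹ x + u g⁻¹)) + u g := by
      funext i x
      rw [← particleInv_map (hρ g), ← hu.isAction.mul, mul_inv_cancel, hu.isAction.one]
    rw [e]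
    exact h.aff.conj hu.isAction g

theorem flip (hu : IsCocycle ρ₀ u) (h : IsConfig ρ₀ n₀ u T t n s p) : ∃ s₀,
    IsConfig ρ₀ n₀ u T.flip ![t 0, t 1, pointInv (t 0) (t 2)]
      (pointInv (t 0) (pointInv (t 2) n)) ![s₀, s 1, pointInv (t 0) (s 2)]
      ![p 0, p 1, particleInv (t 0) (p 0) (p 2)] := by
  obtain ⟨s₀, hs₀⟩ := h.tri.flip
  have m0 := h.tri.mem 0
  refine ⟨s₀, hs₀, ?_, ?_, ?_⟩
  · have e : (fun i (x : V) => pointInv ((![t 0, t 1, pointInv (t 0) (t 2)] : Fin 3 → V) i) x) =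
        ![fun x => pointInv (t 0) x, fun x => pointInv (t 1) x,
          fun x => pointInv (t 0) (pointInv (t 2) (pointInv (t 0) x))] := by
      funext i x
      fin_cases i
      · rfl
      · rfl
      · exact pointInv_conj m0 _ _
    rw [e]
    exact h.lin.flip (isAction_linear ρ₀) h.lin_inv
  · refine h.orb.smul_map T.A⁻¹ one_pos ?_
    rw [one_smul]
    exact ((isAction_linear ρ₀).inv (fun x => (h.lin x).1)
      (f' := fun x => pointInv (t 0) (pointInv (t 2) x)) (fun x => by simp [h.lin_inv]) n).symm
  · have e : (fun i => particleInv ((![t 0, t 1, pointInv (t 0) (t 2)] : Fin 3 → V) i)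
          ((![p 0, p 1, particleInv (t 0) (p 0) (p 2)] : Fin 3 → V) i)) =
        ![particleInv (t 0) (p 0), particleInv (t 1) (p 1),
          fun x => particleInv (t 0) (p 0) (particleInv (t 2) (p 2)
            (particleInv (t 0) (p 0) x))] := by
      funext i x
      fin_cases i
      · rfl
      · rfl
      · exact particleInv_conj m0 _ _ _ _
    rw [e]
    exact h.aff.flip hu.isAction h.aff_inv

end IsConfig

/-! ### Strip coordinates along paths of flips -/

/-- `l` are the strip coordinates of a deformation with positive length derivatives in a
configuration for the basic triple `T`. -/
def HasCoord (ρ₀ : Representation ℝ F2 V) (n₀ : V) (u : F2 → V) (T : BasicTriple)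
    (l : Fin 3 → ℝ) : Prop :=
  ∃ t n s p, IsConfig ρ₀ n₀ u T t n s p ∧ IsStripCoord t s p l ∧ ∀ i j, i ≠ j → 0 < dtrace t p i j

theorem dtrace_map {X : V →ₗ[ℝ] V} (hX : IsSO21 X) (b : V) (t p : Fin 3 → V) (i j : Fin 3) :
    dtrace (fun i => X (t i)) (fun i => X (p i) + b) i j = dtrace t p i j := by
  rw [dtrace, add_sub_add_right_eq_sub, ← map_sub, hX.vol]; rfl

theorem IsStripCoord.map {t s p : Fin 3 → V} {l : Fin 3 → ℝ} (h : IsStripCoord t s p l)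
    {X : V →ₗ[ℝ] V} (hX : IsSO21 X) (b : V) :
    IsStripCoord (fun i => X (t i)) (fun i => X (s i)) (fun i => X (p i) + b) l := by
  intro i j hij
  rw [dtrace_map hX, hX.1, hX.1, h i j hij]

namespace HasCoord

variable {T : BasicTriple} {l : Fin 3 → ℝ}

theorem swap12 (hu : IsCocycle ρ₀ u) (h : HasCoord ρ₀ n₀ u T l) :
    HasCoord ρ₀ n₀ u T.swap12 ![l 0, l 2, l 1] := by
  obtain ⟨t, n, s, p, hc, hl, hd⟩ := h
  refine ⟨_, _, _, _, hc.swap12 hu, ?_, ?_⟩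
  · intro i j hij
    fin_cases i <;> fin_cases j <;> first | exact absurd rfl hij | exact hl _ _ (by decide)
  · intro i j hij
    fin_cases i <;> fin_cases j <;> first | exact absurd rfl hij | exact hd _ _ (by decide)

theorem swap23 (hu : IsCocycle ρ₀ u) (h : HasCoord ρ₀ n₀ u T l) :
    HasCoord ρ₀ n₀ u T.swap23 ![l 2, l 1, l 0] := by
  obtain ⟨t, n, s, p, hc, hl, hd⟩ := h
  refine ⟨_, _, _, _, hc.swap23 hu, ?_, ?_⟩
  · intro i j hij
    fin_cases i <;> fin_cases j <;> first | exact absurd rfl hij | exact hl _ _ (by decide)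
  · intro i j hij
    fin_cases i <;> fin_cases j <;> first | exact absurd rfl hij | exact hd _ _ (by decide)

theorem eps (hu : IsCocycle ρ₀ u) (h : HasCoord ρ₀ n₀ u T l) : HasCoord ρ₀ n₀ u T.eps l := by
  obtain ⟨t, n, s, p, hc, hl, hd⟩ := h
  have hX := isSO21_pointInv (hc.tri.mem 0)
  have e : (fun i => particleInv (t 0) (p 0) (p i)) =
      fun i => pointInv (t 0) (p i) + (p 0 - pointInv (t 0) (p 0)) := by
    funext i
    rw [particleInv_apply, map_sub]; abel
  have hc' := hc.eps hu
  rw [e] at hc'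
  exact ⟨_, _, _, _, hc', hl.map hX _, fun i j hij => by rw [dtrace_map hX]; exact hd i j hij⟩

theorem conj (hρ : ∀ g, IsSO21 (ρ₀ g)) (hu : IsCocycle ρ₀ u) (h : HasCoord ρ₀ n₀ u T l) (g : F2) :
    HasCoord ρ₀ n₀ u (T.conj g) l := by
  obtain ⟨t, n, s, p, hc, hl, hd⟩ := h
  exact ⟨_, _, _, _, hc.conj hρ hu g, hl.map (hρ g) _,
    fun i j hij => by rw [dtrace_map (hρ g)]; exact hd i j hij⟩

theorem flip (hu : IsCocycle ρ₀ u) (h : HasCoord ρ₀ n₀ u T l) (hl0 : 0 < l 0) :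
    ∃ m : Fin 3 → ℝ, HasCoord ρ₀ n₀ u T.flip m ∧ m 0 < 0 ∧ 0 < m 1 ∧ 0 < m 2 := by
  obtain ⟨t, n, s, p, hc, hl, hd⟩ := h
  obtain ⟨s₀, hc'⟩ := hc.flip hu
  have h0 := hc.tri.mem 0
  have pos : ∀ {x : ℝ}, x < 0 → 0 < -2 * x := fun hx => by linarith
  have hneg := fun i j hij => pos (hc.tri.lor_neg (i := i) (j := j) hij)
  have hneg' := fun i j hij => pos (hc'.tri.lor_neg (i := i) (j := j) hij)
  have q10 : lor (pointInv (t 0) (s 2)) (t 0) = lor (s 2) (t 0) := by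
    rw [lor_pointInv_comm, pointInv_self h0]
  have n01 := hneg' 0 1 (by decide)
  have n02 := hneg' 0 2 (by decide)
  have n12 := hneg' 1 2 (by decide)
  have n21 := hneg' 2 1 (by decide)
  simp only [Matrix.cons_val_zero, Matrix.cons_val_one, Matrix.cons_val] at n01 n02 n12 n21
  obtain ⟨m0, m1, m2, hm0, hm1, hm2, hd12, f01, f02, f12⟩ := flip_strip_coord
    (x01 := -2 * lor (t 0) (t 1)) (x02 := -2 * lor (t 0) (t 2))
    n01 n02 (hneg 1 0 (by decide)) (hneg 2 0 (by decide))
    (hneg 0 1 (by decide)) (hneg 0 2 (by decide)) (hneg 1 2 (by decide)) (hneg 2 1 (by decide))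
    n12 n21
    (by rw [pointInv_apply, lor_sub_right, lor_neg_right, lor_smul_right, lor_comm (t 2) (t 0)]
        ring)
    (by rw [lor_pointInv_comm, pointInv_apply, lor_sub_right, lor_neg_right, lor_smul_right,
          lor_comm (t 1) (t 0)]
        ring)
    (hd 0 1 (by decide)) (hd 0 2 (by decide)) hl0
    (hl 0 1 (by decide)) (hl 0 2 (by decide)) (hl 1 2 (by decide))
  have d02 : dtrace ![t 0, t 1, pointInv (t 0) (t 2)] ![p 0, p 1, particleInv (t 0) (p 0) (p 2)]
      0 2 = dtrace t p 0 2 := by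
    simp only [dtrace, Matrix.cons_val_zero, Matrix.cons_val, particleInv_apply, pointInv_apply,
      vol_apply, Pi.sub_apply, Pi.add_apply, Pi.neg_apply, Pi.smul_apply, smul_eq_mul]
    ring
  -- This is the derivative of the trace identity `x₁₂' = x₀₁ x₀₂ - x₁₂` for `x i j = -2 * lor (t i)
  -- (t j)`.
  have d12 : dtrace ![t 0, t 1, pointInv (t 0) (t 2)] ![p 0, p 1, particleInv (t 0) (p 0) (p 2)]
      1 2 = -2 * lor (t 0) (t 1) * dtrace t p 0 2 + -2 * lor (t 0) (t 2) * dtrace t p 0 1 -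
        dtrace t p 1 2 := by
    have e := h0.1
    simp only [lor] at e
    simp only [dtrace, Matrix.cons_val_one, Matrix.cons_val, particleInv_apply, pointInv_apply,
      vol_apply, Pi.sub_apply, Pi.add_apply, Pi.neg_apply, Pi.smul_apply, smul_eq_mul, lor]
    -- The identity holds modulo `lor (t 0) (t 0) = -1`, with coefficient `4 * vol (t 1) (t 2) (p 2
    -- - p 0)`.
    linear_combination 4 * (t 1 0 * (t 2 1 * (p 2 2 - p 0 2) - t 2 2 * (p 2 1 - p 0 1)) -
      t 1 1 * (t 2 0 * (p 2 2 - p 0 2) - t 2 2 * (p 2 0 - p 0 0)) +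
      t 1 2 * (t 2 0 * (p 2 1 - p 0 1) - t 2 1 * (p 2 0 - p 0 0))) * e
  refine ⟨![m0, m1, m2], ⟨_, _, _, _, hc', ?_, ?_⟩, hm0, hm1, hm2⟩
  · have key : ∀ {t s p : Fin 3 → V} {l : Fin 3 → ℝ},
        dtrace t p 0 1 = l 0 * (-2 * lor (s 0) (t 1)) + l 1 * (-2 * lor (s 1) (t 0)) →
        dtrace t p 0 2 = l 0 * (-2 * lor (s 0) (t 2)) + l 2 * (-2 * lor (s 2) (t 0)) →
        dtrace t p 1 2 = l 1 * (-2 * lor (s 1) (t 2)) + l 2 * (-2 * lor (s 2) (t 1)) →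
        IsStripCoord t s p l := by
      intro t s p l e1 e2 e3 i j hij
      fin_cases i <;> fin_cases j <;> first | exact absurd rfl hij | assumption | skip
      · exact (dtrace_comm _ _ _ _).trans (e1.trans (add_comm _ _))
      · exact (dtrace_comm _ _ _ _).trans (e2.trans (add_comm _ _))
      · exact (dtrace_comm _ _ _ _).trans (e3.trans (add_comm _ _))
    refine key f01 ?_ ?_
    · rw [d02, f02]
      simp [q10]
    · rw [d12, f12]
      simp
  · have key : ∀ {t p : Fin 3 → V}, 0 < dtrace t p 0 1 → 0 < dtrace t p 0 2 →
        0 < dtrace t p 1 2 → ∀ i j, i ≠ j → 0 < dtrace t p i j := by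
      intro t p e1 e2 e3 i j hij
      fin_cases i <;> fin_cases j <;> first | exact absurd rfl hij | assumption | skip
      · exact e1.trans_eq (dtrace_comm _ _ _ _)
      · exact e2.trans_eq (dtrace_comm _ _ _ _)
      · exact e3.trans_eq (dtrace_comm _ _ _ _)
    exact key (hd 0 1 (by decide)) (by rw [d02]; exact hd 0 2 (by decide)) (by rwa [d12])

end HasCoord

/-- Along paths without backtracking starting in a triple with positive strip coordinates, exactly
the coordinate of the arc created last is negative. -/
theorem BasicTriple.Reached.exists_hasCoord (hρ : ∀ g, IsSO21 (ρ₀ g)) (hu : IsCocycle ρ₀ u)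
    {T₀ : BasicTriple} {l₀ : Fin 3 → ℝ} (h₀ : HasCoord ρ₀ n₀ u T₀ l₀) (hl₀ : ∀ i, 0 < l₀ i)
    {T : BasicTriple} {k : Fin 3} (h : Reached T₀ T k) :
    ∃ l, HasCoord ρ₀ n₀ u T l ∧ l k < 0 ∧ ∀ i, i ≠ k → 0 < l i := by
  have sim : ∀ {T}, Similar T₀ T → ∃ l, HasCoord ρ₀ n₀ u T l ∧ ∀ i, 0 < l i := by
    intro T h
    induction h with
    | refl => exact ⟨l₀, h₀, hl₀⟩
    | swap12 _ ih =>
      obtain ⟨l, hl, hp⟩ := ih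
      exact ⟨_, hl.swap12 hu, fun i => by fin_cases i <;> exact hp _⟩
    | swap23 _ ih =>
      obtain ⟨l, hl, hp⟩ := ih
      exact ⟨_, hl.swap23 hu, fun i => by fin_cases i <;> exact hp _⟩
    | eps _ ih =>
      obtain ⟨l, hl, hp⟩ := ih
      exact ⟨_, hl.eps hu, hp⟩
    | conj g _ ih =>
      obtain ⟨l, hl, hp⟩ := ih
      exact ⟨_, hl.conj hρ hu g, hp⟩
  have flip : ∀ {T l}, HasCoord ρ₀ n₀ u T l → 0 < l 0 →
      ∃ l, HasCoord ρ₀ n₀ u T.flip l ∧ l 0 < 0 ∧ ∀ i, i ≠ 0 → 0 < l i := by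
    intro T l hl h0
    obtain ⟨m, hm, m0, m1, m2⟩ := hl.flip hu h0
    refine ⟨m, hm, m0, fun i hi => ?_⟩
    fin_cases i
    · exact absurd rfl hi
    · exact m1
    · exact m2
  induction h with
  | first h =>
    obtain ⟨l, hl, hp⟩ := sim h
    exact flip hl (hp 0)
  | step _ hk ih =>
    obtain ⟨l, hl, -, hp⟩ := ih
    exact flip hl (hp 0 hk.symm)
  | @swap12 T k _ ih =>
    obtain ⟨l, hl, hn, hp⟩ := ih
    have e : (![l 0, l 2, l 1] : Fin 3 → ℝ) = fun i => l (Equiv.swap 1 2 i) := by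
      funext i; fin_cases i <;> rfl
    refine ⟨_, hl.swap12 hu, ?_, fun i hi => ?_⟩
    · rw [e]; simpa using hn
    · rw [e]; exact hp _ fun h => hi (by rw [← h, Equiv.swap_apply_self])
  | @swap23 T k _ ih =>
    obtain ⟨l, hl, hn, hp⟩ := ih
    have e : (![l 2, l 1, l 0] : Fin 3 → ℝ) = fun i => l (Equiv.swap 0 2 i) := by
      funext i; fin_cases i <;> rfl
    refine ⟨_, hl.swap23 hu, ?_, fun i hi => ?_⟩
    · rw [e]; simpa using hn
    · rw [e]; exact hp _ fun h => hi (by rw [← h, Equiv.swap_apply_self])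
  | eps _ ih =>
    obtain ⟨l, hl, hp⟩ := ih
    exact ⟨_, hl.eps hu, hp⟩
  | conj g _ ih =>
    obtain ⟨l, hl, hp⟩ := ih
    exact ⟨_, hl.conj hρ hu g, hp⟩

end Config


/-! ### Null frames -/

/-- Null vectors `n, m` and a unit vector `e` orthogonal to both. -/
structure IsNullFrame (n m e : V) : Prop where
  nn : lor n n = 0
  mm : lor m m = 0
  nm : lor n m ≠ 0
  ee : lor e e = 1
  en : lor e n = 0
  em : lor e m = 0

theorem exists_isNullFrame {n m : V} (hn : lor n n = 0) (hm : lor m m = 0) (hnm : lor n m ≠ 0) :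
    ∃ e, IsNullFrame n m e := by
  refine ⟨(lor n m)⁻¹ • lcross n m, hn, hm, hnm, ?_, ?_, ?_⟩
  · rw [lor_smul_left, lor_smul_right, lor_lcross_lcross, hn]; field_simp; ring
  · rw [lor_smul_left, lor_lcross, vol_apply]; ring
  · rw [lor_smul_left, lor_lcross, vol_apply]; ring

namespace IsNullFrame

variable {n m e : V}

theorem vol_ne_zero (h : IsNullFrame n m e) : vol n m e ≠ 0 := by
  intro h0
  have h1 := vol_mul_vol h.ee h.en m h.en h.em
  rw [h0, h.nn, lor_comm m n] at h1
  exact h.nm (pow_eq_zero_iff two_ne_zero |>.1 (by linarith))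

theorem decomp (h : IsNullFrame n m e) (v : V) :
    v = (lor v m / lor n m) • n + (lor v n / lor n m) • m + lor v e • e := by
  have hnm := h.nm
  set w := v - ((lor v m / lor n m) • n + (lor v n / lor n m) • m + lor v e • e) with hw
  have w1 : lor w n = 0 := by
    rw [hw, lor_sub_left, lor_add_left, lor_add_left, lor_smul_left, lor_smul_left, lor_smul_left,
      h.nn, h.en, lor_comm m n, div_mul_cancel₀ _ hnm]; ring
  have w2 : lor w m = 0 := by
    rw [hw, lor_sub_left, lor_add_left, lor_add_left, lor_smul_left, lor_smul_left, lor_smul_left,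
      h.mm, h.em, div_mul_cancel₀ _ hnm]; ring
  have w3 : lor w e = 0 := by
    rw [hw, lor_sub_left, lor_add_left, lor_add_left, lor_smul_left, lor_smul_left, lor_smul_left,
      lor_comm n e, lor_comm m e, h.en, h.em, h.ee]; ring
  have w0 : w = 0 := by
    refine ext_lor fun x => mul_left_cancel₀ h.vol_ne_zero ?_
    rw [← lor_smul_right, vol_smul_eq n m e x, lor_add_right, lor_add_right, lor_smul_right,
      lor_smul_right, lor_smul_right, w1, w2, w3]
    simp [lor]
  rw [hw, sub_eq_zero] at w0
  exact w0

/-- The eigenvalues satisfy `a * b = 1`. The image of `e` is again orthogonal to `n` and `m`, hence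
a multiple of `e`, and preservation of volume makes the factor `1`. -/
theorem map_e (h : IsNullFrame n m e) {X : V →ₗ[ℝ] V} (hX : IsSO21 X) {a b : ℝ}
    (hn : X n = a • n) (hm : X m = b • m) : X e = e := by
  have hab : a * b = 1 := by
    have h1 := hX.1 n m
    rw [hn, hm, lor_smul_left, lor_smul_right, ← mul_assoc] at h1
    exact mul_right_cancel₀ h.nm (by rw [h1, one_mul])
  have h1 := hX.1 e n
  have h2 := hX.1 e m
  rw [hn, lor_smul_right, h.en] at h1
  rw [hm, lor_smul_right, h.em] at h2
  have h1' := (mul_eq_zero.1 h1).resolve_left (left_ne_zero_of_mul_eq_one hab)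
  have h2' := (mul_eq_zero.1 h2).resolve_left (right_ne_zero_of_mul_eq_one hab)
  have h3 := h.decomp (X e)
  rw [h1', h2', zero_div, zero_smul, zero_smul, zero_add, zero_add] at h3
  have h4 := hX.vol n m e
  rw [hn, hm, h3] at h4
  have h5 : vol (a • n) (b • m) (lor (X e) e • e) = a * b * lor (X e) e * vol n m e := by
    simp only [vol_apply, Pi.smul_apply, smul_eq_mul]; ring
  rw [h5, hab, one_mul] at h4
  have h6 : lor (X e) e = 1 := mul_right_cancel₀ h.vol_ne_zero (by rw [h4, one_mul])
  rw [h3, h6, one_smul]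

theorem eq_id (h : IsNullFrame n m e) {X : V →ₗ[ℝ] V} (hX : IsSO21 X)
    (hn : X n = n) (hm : X m = m) : X = LinearMap.id := by
  have he := h.map_e hX (a := 1) (b := 1) (by rw [hn, one_smul]) (by rw [hm, one_smul])
  refine LinearMap.ext fun v => ?_
  conv_lhs => rw [h.decomp v]
  rw [map_add, map_add, map_smul, map_smul, map_smul, hn, hm, he, ← h.decomp v]
  rfl

/-- An isometry which fixes the null vector `m` is unipotent. -/
theorem map_of_fixed (h : IsNullFrame n m e) {X : V →ₗ[ℝ] V} (hX : IsSO21 X) (hm : X m = m) :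
    ∃ a b c : ℝ, ∀ v, X v = v + (lor v m) • (a • m + b • e) + (lor v e * c) • m := by
  have hnm := h.nm
  have h1 : lor (X n) m = lor n m := by conv_lhs => rw [← hm, hX.1]
  have h2 : lor (X e) m = 0 := by conv_lhs => rw [← hm, hX.1, h.em]
  have hn := h.decomp (X n)
  have he := h.decomp (X e)
  rw [h1, div_self hnm, one_smul] at hn
  rw [h2, zero_div, zero_smul, zero_add] at he
  have h4 := hX.vol n m e
  rw [hm, hn, he] at h4
  have h5 : ∀ x y z w : ℝ, vol (n + x • m + y • e) m (z • m + w • e) = w * vol n m e := by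
    intro x y z w
    simp only [vol_apply, Pi.smul_apply, Pi.add_apply, smul_eq_mul]; ring
  rw [h5] at h4
  have h6 : lor (X e) e = 1 := mul_right_cancel₀ h.vol_ne_zero (by rw [h4, one_mul])
  rw [h6, one_smul] at he
  obtain ⟨x, y, hn⟩ : ∃ x y : ℝ, X n = n + x • m + y • e := ⟨_, _, hn⟩
  obtain ⟨z, he⟩ : ∃ z : ℝ, X e = z • m + e := ⟨_, he⟩
  refine ⟨x / lor n m, y / lor n m, z, fun v => ?_⟩
  have hv := h.decomp v
  have hXv : X v = (lor v m / lor n m) • X n + (lor v n / lor n m) • m + lor v e • X e := by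
    conv_lhs => rw [hv]
    rw [map_add, map_add, map_smul, map_smul, map_smul, hm]
  rw [hXv, hn, he]
  generalize lor v m = r1 at *
  generalize lor v n = r2 at *
  generalize lor v e = r3 at *
  rw [hv]
  module

end IsNullFrame

/-! ### Fixed points of the boundary holonomy in one orbit -/

section Discrete

open Filter Topology

variable {ρ₀ : Representation ℝ F2 V}

/-- In a discrete faithful representation the conjugates of an element by powers of another one
can only converge to the identity if the element is trivial. -/
theorem eq_one_of_tendsto (hρ₀ : IsOneHoledTorus ρ₀) {k h : F2}
    (hlim : ∀ v, Tendsto (fun j : ℕ => ρ₀ (k ^ j * h * (k ^ j)⁻¹) v) atTop (𝓝 v)) : h = 1 := by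
  have := hρ₀.discrete
  let S := Set.range fun g => LinearMap.toMatrix' (ρ₀ g)
  let y : ℕ → S := fun j => ⟨_, k ^ j * h * (k ^ j)⁻¹, rfl⟩
  let y₀ : S := ⟨_, 1, rfl⟩
  have hy : Tendsto y atTop (𝓝 y₀) := by
    rw [tendsto_subtype_rng]
    refine tendsto_pi_nhds.2 fun a => tendsto_pi_nhds.2 fun b => ?_
    simp only [y, y₀, LinearMap.toMatrix'_apply, map_one, Module.End.one_apply]
    exact ((continuous_apply a).tendsto _).comp (hlim _)
  -- In a discrete set convergence means eventual equality, so some conjugate is already trivial.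
  rw [nhds_discrete, tendsto_pure] at hy
  obtain ⟨j, hj⟩ := hy.exists
  have h1 := hρ₀.faithful (LinearMap.toMatrix'.injective (congrArg Subtype.val hj))
  have h2 : h = (k ^ j)⁻¹ * (k ^ j * h * (k ^ j)⁻¹) * k ^ j := by group
  rw [h2, h1]
  group

theorem map_inv_apply_eq {g : F2} {x y : V} (h : ρ₀ g x = y) : ρ₀ g⁻¹ y = x := by
  rw [← h, ← Module.End.mul_apply, ← map_mul, inv_mul_cancel, map_one, Module.End.one_apply]

/-- The two fixed points of a hyperbolic element of a discrete faithful representation lie in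
different orbits. -/
theorem not_sameOrbit_of_eigenvectors (hρ₀ : IsOneHoledTorus ρ₀) {n m : V} (hn : n ∈ FutureNull)
    (hm : m ∈ FutureNull) (hnm : lor n m ≠ 0) {k g : F2} {θ c : ℝ} (h0 : 0 < θ) (h1 : θ < 1)
    (hkn : ρ₀ k n = θ⁻¹ • n) (hkm : ρ₀ k m = θ • m) (hc : c ≠ 0) (hg : ρ₀ g n = c • m) : False := by
  have hS := hρ₀.isSO21
  obtain ⟨e, hF⟩ := exists_isNullFrame hn.1 hm.1 hnm
  have hke : ρ₀ k e = e := hF.map_e (hS k) hkn hkm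
  have hmulapp : ∀ a b v, ρ₀ (a * b) v = ρ₀ a (ρ₀ b v) := fun a b v => by
    rw [map_mul, Module.End.mul_apply]
  have hgm : ρ₀ g⁻¹ m = c⁻¹ • n := by
    refine map_inv_apply_eq ?_
    rw [map_smul, hg, smul_smul, inv_mul_cancel₀ hc, one_smul]
  -- The conjugate `g * k * g⁻¹` expands `m` by the factor by which `k` contracts it, so this
  -- product is unipotent at `m`. Conjugating it by powers of `k` scales its nontrivial terms by
  -- powers of `θ < 1`. It is therefore trivial, and `g` conjugates `k` to its inverse.
  have hhm : ρ₀ (g * k * g⁻¹ * k) m = m := by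
    simp only [hmulapp, map_smul, hkm, hgm, hkn, hg, smul_smul]
    rw [show θ * c⁻¹ * θ⁻¹ * c = 1 by field_simp, one_smul]
  obtain ⟨a, b, d, hX⟩ := hF.map_of_fixed (hS _) hhm
  have hpow : ∀ (j : ℕ) v, ρ₀ (k ^ j * (g * k * g⁻¹ * k) * (k ^ j)⁻¹) v =
      v + lor v m • ((a * (θ ^ j * θ ^ j)) • m + (b * θ ^ j) • e) +
        (lor v e * (d * θ ^ j)) • m := by
    intro j
    induction j with
    | zero => intro v; simpa using hX v
    | succ j ih =>
      intro v
      have e1 : k ^ (j + 1) * (g * k * g⁻¹ * k) * (k ^ (j + 1))⁻¹ =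
        k * (k ^ j * (g * k * g⁻¹ * k) * (k ^ j)⁻¹) * k⁻¹ := by
        rw [pow_succ']; group
      have e2 : ρ₀ k (ρ₀ k⁻¹ v) = v := by rw [← hmulapp, mul_inv_cancel]; simp
      have e3 : lor (ρ₀ k⁻¹ v) m = θ * lor v m := by
        rw [← (hS k).1, e2, hkm, lor_smul_right]
      have e4 : lor (ρ₀ k⁻¹ v) e = lor v e := by rw [← (hS k).1, e2, hke]
      rw [e1, hmulapp, hmulapp, ih, e3, e4]
      simp only [map_add, map_smul, e2, hkm, hke]
      module
  have hh : g * k * g⁻¹ * k = 1 := by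
    refine eq_one_of_tendsto hρ₀ (k := k) fun v => ?_
    simp only [hpow]
    have hθ := tendsto_pow_atTop_nhds_zero_of_lt_one h0.le h1
    have l1 := ((hθ.mul hθ).const_mul a).smul_const m
    have l2 := (hθ.const_mul b).smul_const e
    have l3 := ((hθ.const_mul d).const_mul (lor v e)).smul_const m
    have l4 := ((l1.add l2).const_smul (lor v m)).const_add v
    simpa using l4.add l3
  have hgk : k * g * k = g := by
    have e1 : g * k = (k)⁻¹ * g := by
      have := eq_inv_of_mul_eq_one_left hh
      rw [← this]; group
    rw [mul_assoc, e1]; group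
  have hw : ρ₀ k (ρ₀ g m) = θ⁻¹ • ρ₀ g m := by
    have e1 : ρ₀ k (ρ₀ g (ρ₀ k m)) = ρ₀ g m := by rw [← hmulapp, ← hmulapp, hgk]
    rw [hkm, map_smul, map_smul] at e1
    conv_rhs => rw [← e1]
    rw [smul_smul, inv_mul_cancel₀ h0.ne', one_smul]
  have hwn : lor (ρ₀ g m) n = 0 := by
    have e1 := (hS k).1 (ρ₀ g m) n
    rw [hw, hkn, lor_smul_left, lor_smul_right, ← mul_assoc] at e1
    have h2 : 1 < θ⁻¹ * θ⁻¹ := by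
      have := (one_lt_inv₀ h0).2 h1
      nlinarith
    by_contra hne
    have := mul_right_cancel₀ hne (e1.trans (one_mul _).symm)
    linarith
  have hgm' := eq_smul_of_lor_eq_zero ((hS g).mem_futureNull hm) hn hwn
  set y := (ρ₀ g m) 2 / n 2
  have hyc : c * y = 1 := by
    have e1 := (hS g).1 n m
    rw [hg, hgm', lor_smul_left, lor_smul_right, lor_comm m n, ← mul_assoc] at e1
    exact mul_right_cancel₀ hnm (e1.trans (one_mul _).symm)
  -- Now `g` exchanges the rays of `n` and `m`, with factors of product `1`. Its square is trivial,
  -- and the free group has no torsion.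
  have hgg : ρ₀ (g * g) = LinearMap.id := by
    refine hF.eq_id (hS _) ?_ ?_
    · rw [hmulapp, hg, map_smul, hgm', smul_smul, hyc, one_smul]
    · rw [hmulapp, hgm', map_smul, hg, smul_smul, mul_comm, hyc, one_smul]
  have hg2 : g ^ 2 = 1 := hρ₀.faithful (by rw [sq, hgg, map_one]; rfl)
  have hg1 : g = 1 := (pow_eq_one_iff_left two_ne_zero).1 hg2
  rw [hg1, map_one, Module.End.one_apply] at hg
  rw [hg, lor_smul_left, hm.1, mul_zero] at hnm
  exact hnm rfl

end Discrete

/-! ### Uniqueness of configurations -/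

section Unique

theorem H2_eq_of_smul {t t' : V} (ht : t ∈ H2) (ht' : t' ∈ H2) {a b : ℝ} (ha : a ≠ 0)
    (h : a • t' = b • t) : t' = t := by
  have e : t' = (b / a) • t := by
    rw [div_eq_inv_mul, ← smul_smul, ← h, smul_smul, inv_mul_cancel₀ ha, one_smul]
  have h1 := ht'.1
  have h2 := ht'.2
  rw [e, lor_smul_left, lor_smul_right, ht.1] at h1
  rw [e, Pi.smul_apply, smul_eq_mul] at h2
  have h3 := pos_of_mul_pos_left h2 ht.2.le
  have h4 : b / a = 1 := by nlinarith
  rw [e, h4, one_smul]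

/-- The cross product of `b` and `a` is fixed by the composite of their symmetries. If the composite
for `a', b'` fixes it too, independence of `a'` and `b'` makes it orthogonal to both: the axes
agree. -/
theorem vol_eq_zero_of_comp_eq {a b a' b' w : V} (hw : vol a' b' w ≠ 0) (hb : b' ∈ H2)
    (h : ∀ v, pointInv b (pointInv a v) = pointInv b' (pointInv a' v)) :
    vol b a a' = 0 ∧ vol b a b' = 0 := by
  have e1 : lor (lcross b a) a = 0 := by rw [lor_lcross, vol_apply]; ring
  have e2 : lor (lcross b a) b = 0 := by rw [lor_lcross, vol_apply]; ring
  have h1 := h (lcross b a)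
  have h2 : pointInv b (pointInv a (lcross b a)) = lcross b a := by
    rw [pointInv_apply a, e1, mul_zero, zero_smul, sub_zero, map_neg, pointInv_apply, e2, mul_zero,
      zero_smul, sub_zero, neg_neg]
  rw [h2] at h1
  have h3 := congrArg (pointInv b') h1
  rw [pointInv_pointInv hb, pointInv_apply, pointInv_apply, lor_lcross, lor_lcross] at h3
  have h4 : vol b a b' • b' = vol b a a' • a' := by
    have h5 : (2 : ℝ) • (vol b a b' • b') = (2 : ℝ) • (vol b a a' • a') := by
      rw [smul_smul, smul_smul]; exact sub_right_injective h3
    exact smul_right_injective V (two_ne_zero (α := ℝ)) h5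
  have vs : ∀ (r : ℝ) x y z, vol (r • x) y z = r * vol x y z := fun r x y z => by
    simp only [vol_apply, Pi.smul_apply, smul_eq_mul]; ring
  have v0 : ∀ x y, vol x x y = 0 := fun x y => by rw [vol_apply]; ring
  have v1 : vol b' a' w = -vol a' b' w := by rw [vol_apply, vol_apply]; ring
  constructor
  · have h6 := congrArg (fun x => vol x b' w) h4
    simp only [vs, v0, mul_zero] at h6
    exact (mul_eq_zero.1 h6.symm).resolve_right hw
  · have h6 := congrArg (fun x => vol x a' w) h4
    simp only [vs, v0, mul_zero, v1] at h6
    exact (mul_eq_zero.1 h6).resolve_right (neg_ne_zero.2 hw)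

/-- Pairing the displacement of the composite with its invariant vector, the cross product of `b`
and `a`, recovers the Margulis invariant. It suffices to evaluate at the origin. -/
theorem vol_particle_eq {a b p q p' q' : V}
    (h : ∀ x, particleInv b q (particleInv a p x) = particleInv b q' (particleInv a p' x)) :
    vol b a (q - p) = vol b a (q' - p') := by
  have h1 := congrArg (vol b a) (h 0)
  simp only [particleInv_apply, pointInv_apply, vol_apply, Pi.sub_apply, Pi.add_apply, lor,
    Pi.neg_apply, Pi.smul_apply, smul_eq_mul, Pi.zero_apply] at h1 ⊢
  linear_combination (1 / 2) * h1

variable {ρ₀ : Representation ℝ F2 V} {n₀ : V} {u : F2 → V} {T : BasicTriple}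
  {t t' : Fin 3 → V} {n n' : V} {s s' p p' : Fin 3 → V}

/-- Each point lies on two of the three axes of `A`, `B` and `C`, and these axes are determined by
the linear parts. -/
theorem IsConfig.points_eq (h : IsConfig ρ₀ n₀ u T t n s p)
    (h' : IsConfig ρ₀ n₀ u T t' n' s' p') : t' = t := by
  have hv := h.tri.vol_points_ne_zero
  have hv' := h'.tri.vol_points_ne_zero
  have v120 : vol (t' 1) (t' 2) (t' 0) ≠ 0 := by
    intro h0; apply hv'; rw [← h0, vol_apply, vol_apply]; ring
  have v201 : vol (t' 2) (t' 0) (t' 1) ≠ 0 := by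
    intro h0; apply hv'; rw [← h0, vol_apply, vol_apply]; ring
  have v021 : vol (t' 0) (t' 2) (t' 1) ≠ 0 := by
    intro h0; apply v201; rw [← neg_eq_zero, ← h0, vol_apply, vol_apply]; ring
  have v102 : vol (t' 1) (t' 0) (t' 2) ≠ 0 := by
    intro h0; apply hv'; rw [← neg_eq_zero, ← h0, vol_apply, vol_apply]; ring
  have v210 : vol (t' 2) (t' 1) (t' 0) ≠ 0 := by
    intro h0; apply v120; rw [← neg_eq_zero, ← h0, vol_apply, vol_apply]; ring
  obtain ⟨a1, a2⟩ := vol_eq_zero_of_comp_eq (a := t 0) (b := t 2) v021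
    (h'.tri.mem 2) fun v => (h.lin v).1.symm.trans (h'.lin v).1
  obtain ⟨b1, b2⟩ := vol_eq_zero_of_comp_eq (a := t 1) (b := t 0) v102
    (h'.tri.mem 0) fun v => (h.lin v).2.1.symm.trans (h'.lin v).2.1
  obtain ⟨c1, c2⟩ := vol_eq_zero_of_comp_eq (a := t 2) (b := t 1) v210
    (h'.tri.mem 1) fun v => (h.lin v).2.2.symm.trans (h'.lin v).2.2
  have cyc : ∀ x y z, vol z x y = vol x y z := fun x y z => by
    rw [vol_apply, vol_apply]; ring
  have key := vol_smul_eq (t 0) (t 1) (t 2)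
  have k0 : t' 0 = t 0 := by
    have z1 : vol (t 0) (t' 0) (t 2) = 0 := by rw [← cyc]; exact a1
    refine H2_eq_of_smul (h.tri.mem 0) (h'.tri.mem 0) hv
      (b := vol (t' 0) (t 1) (t 2)) ?_
    rw [key, z1, b2, zero_smul, zero_smul, add_zero, add_zero]
  have k1 : t' 1 = t 1 := by
    have z1 : vol (t' 1) (t 1) (t 2) = 0 := by rw [← cyc, ← cyc]; exact c2
    refine H2_eq_of_smul (h.tri.mem 1) (h'.tri.mem 1) hv
      (b := vol (t 0) (t' 1) (t 2)) ?_
    rw [key, z1, b1, zero_smul, zero_smul, add_zero, zero_add]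
  have k2 : t' 2 = t 2 := by
    have z1 : vol (t' 2) (t 1) (t 2) = 0 := by rw [← cyc, ← cyc]; exact c1
    have z2 : vol (t 0) (t' 2) (t 2) = 0 := by rw [← cyc]; exact a2
    refine H2_eq_of_smul (h.tri.mem 2) (h'.tri.mem 2) hv
      (b := vol (t 0) (t 1) (t' 2)) ?_
    rw [key, z1, z2, zero_smul, zero_smul, zero_add, zero_add]
  funext i
  fin_cases i <;> assumption

/-- The vertex of the ideal triangle of a configuration is determined by its orbit. -/
theorem IsConfig.vertex_eq (hρ₀ : IsOneHoledTorus ρ₀) (h : IsConfig ρ₀ n₀ u T t n s p)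
    (h' : IsConfig ρ₀ n₀ u T t n' s' p') : ∃ r : ℝ, 0 < r ∧ n' = r • n := by
  have hn := h.tri.vertex
  have hn' := h'.tri.vertex
  suffices h0 : lor n' n = 0 from
    ⟨_, div_pos hn'.2 hn.2, eq_smul_of_lor_eq_zero hn' hn h0⟩
  by_contra hne
  rw [lor_comm] at hne
  obtain ⟨g₁, c₁, hc₁, hg₁⟩ := h.orb
  obtain ⟨g₂, c₂, hc₂, hg₂⟩ := h'.orb
  have hmulapp : ∀ a b v, ρ₀ (a * b) v = ρ₀ a (ρ₀ b v) := fun a b v => by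
    rw [map_mul, Module.End.mul_apply]
  have hg : ρ₀ (g₂ * g₁⁻¹) n = (c₁ / c₂) • n' := by
    rw [hg₁, hg₂, map_smul, hmulapp, map_inv_apply_eq rfl, smul_smul, div_mul_cancel₀ _ hc₂.ne']
  obtain ⟨c, hc, hcn⟩ := h.tri.exists_pos
  obtain ⟨c', hc', hcn'⟩ := h'.tri.exists_pos
  have hιι := h.tri.mem
  have hcc : c * c' = 1 := by
    have e1 : lor (c • n) (c' • n') = lor n n' := by
      rw [← hcn, ← hcn', lor_pointInv (hιι 0), lor_pointInv (hιι 1), lor_pointInv (hιι 2)]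
    rw [lor_smul_left, lor_smul_right, ← mul_assoc] at e1
    exact mul_right_cancel₀ hne (e1.trans (one_mul _).symm)
  -- The square of `ι₀ι₁ι₂` belongs to the free group: it is the image of `B * A * C`.
  have hk : ∀ v, ρ₀ (T.B * T.A * T.C) v = pointInv (t 0) (pointInv (t 1) (pointInv (t 2)
      (pointInv (t 0) (pointInv (t 1) (pointInv (t 2) v))))) := by
    intro v
    rw [hmulapp, hmulapp]
    have e1 := fun v => (h.lin v).1
    have e2 := fun v => (h.lin v).2.1
    have e3 := fun v => (h.lin v).2.2
    simp only at e1 e2 e3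
    rw [e3, e1, e2]
  have hkn : ρ₀ (T.B * T.A * T.C) n = (c * c) • n := by
    rw [hk, hcn]; simp only [map_smul]; rw [hcn, smul_smul]
  have hkn' : ρ₀ (T.B * T.A * T.C) n' = (c' * c') • n' := by
    rw [hk, hcn']; simp only [map_smul]; rw [hcn', smul_smul]
  have hc'' : c' = c⁻¹ := eq_inv_of_mul_eq_one_right hcc
  -- If `c * c = 1`, the square fixes two null directions pointwise and is the identity, so `B * A *
  -- C = A * B * C` and `A`, `B` commute. Otherwise the square or its inverse expands `n` and
  -- contracts `n'`.
  rcases lt_trichotomy (c * c) 1 with hlt | heq | hgt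
  · refine not_sameOrbit_of_eigenvectors hρ₀ hn hn' hne (k := (T.B * T.A * T.C)⁻¹)
      (mul_pos hc hc) hlt ?_ ?_ (div_pos hc₁ hc₂).ne' hg
    · refine map_inv_apply_eq ?_
      rw [map_smul, hkn, smul_smul, inv_mul_cancel₀ (mul_pos hc hc).ne', one_smul]
    · refine map_inv_apply_eq ?_
      rw [map_smul, hkn', smul_smul, show c * c * (c' * c') = 1 by
        rw [mul_mul_mul_comm, hcc, one_mul], one_smul]
  · obtain ⟨e, hF⟩ := exists_isNullFrame hn.1 hn'.1 hne
    have hid := hF.eq_id (hρ₀.isSO21 (T.B * T.A * T.C)) (by rw [hkn, heq, one_smul]) (by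
      rw [hkn', show c' * c' = 1 by rw [hc'', ← mul_inv, heq, inv_one], one_smul])
    have h1 : T.B * T.A * T.C = 1 := hρ₀.faithful (by rw [hid, map_one]; rfl)
    refine T.basis.not_commute ?_
    have e1 := eq_inv_of_mul_eq_one_left T.mul_eq_one
    have e2 := eq_inv_of_mul_eq_one_left h1
    exact e1.trans e2.symm
  · refine not_sameOrbit_of_eigenvectors hρ₀ hn hn' hne (k := T.B * T.A * T.C)
      (θ := (c * c)⁻¹) (inv_pos.2 (mul_pos hc hc)) (inv_lt_one_of_one_lt₀ hgt) ?_ ?_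
      (div_pos hc₁ hc₂).ne' hg
    · rw [hkn, inv_inv]
    · rw [hkn', hc'', mul_inv]

theorem IsTriangle.normals_eq (h : IsTriangle t n s) {r : ℝ} (hr : 0 < r)
    (h' : IsTriangle t (r • n) s') : s' = s := by
  obtain ⟨c, hc, hc'⟩ := h.exists_pos_one
  have l0 := h.lor_vertices_ne_zero
  have l2 := h.swap23.lor_vertices_ne_zero
  have l1 := h.swap12.swap23.lor_vertices_ne_zero
  simp only [Matrix.cons_val_zero, Matrix.cons_val, hc', lor_smul_right] at l1 l2
  have l1' := right_ne_zero_of_mul l1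
  rw [lor_comm] at l2
  have e : ∀ v : V, r⁻¹ • r • v = v := fun v => by
    rw [smul_smul, inv_mul_cancel₀ hr.ne', one_smul]
  obtain ⟨-, -, h0, h1, h2⟩ := h.tri
  obtain ⟨-, -, h0', h1', h2'⟩ := h'.tri
  simp only [map_smul] at h0' h1' h2'
  replace h0' := h0'.smul (a := r⁻¹) (b := r⁻¹) (inv_pos.2 hr)
  replace h1' := h1'.smul (a := r⁻¹) (b := r⁻¹) (inv_pos.2 hr)
  replace h2' := h2'.smul (a := r⁻¹) (b := r⁻¹) (inv_pos.2 hr)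
  simp only [e] at h0' h1' h2'
  funext i
  fin_cases i
  · exact h0'.unique h0 h.vertex.1 l0
  · exact h1'.unique h1 (h.vertex_image 0).1 l1'
  · exact h2'.unique h2 (h.vertex_image 2).1 l2

/-- The triple fixes the points, the orbit fixes the vertex up to scale and hence the normals, and
`u` fixes the derivatives. The linear system for the coordinates is then the same and nonsingular.
-/
theorem HasCoord.unique (hρ₀ : IsOneHoledTorus ρ₀) {l l' : Fin 3 → ℝ}
    (h : HasCoord ρ₀ n₀ u T l) (h' : HasCoord ρ₀ n₀ u T l') : l = l' := by
  obtain ⟨t, n, s, p, hc, hl, -⟩ := h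
  obtain ⟨t', n', s', p', hc', hl', -⟩ := h'
  obtain rfl := hc.points_eq hc'
  obtain ⟨r, hr, rfl⟩ := hc.vertex_eq hρ₀ hc'
  obtain rfl := hc.tri.normals_eq hr hc'.tri
  have d20 : dtrace t' p 2 0 = dtrace t' p' 2 0 := congrArg (-2 * ·) <|
    vol_particle_eq fun x =>
      ((hc.aff x).1.symm.trans (hc'.aff x).1)
  have d01 : dtrace t' p 0 1 = dtrace t' p' 0 1 := congrArg (-2 * ·) <|
    vol_particle_eq fun x =>
      ((hc.aff x).2.1.symm.trans (hc'.aff x).2.1)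
  have d12 : dtrace t' p 1 2 = dtrace t' p' 1 2 := congrArg (-2 * ·) <|
    vol_particle_eq fun x =>
      ((hc.aff x).2.2.symm.trans (hc'.aff x).2.2)
  have hd : ∀ i j, i ≠ j → dtrace t' p i j = dtrace t' p' i j := by
    intro i j hij
    fin_cases i <;> fin_cases j <;> first | exact absurd rfl hij | assumption | skip
    · rw [dtrace_comm, dtrace_comm _ p']; exact d20
    · rw [dtrace_comm, dtrace_comm _ p']; exact d01
    · rw [dtrace_comm, dtrace_comm _ p']; exact d12
  exact hl.unique (fun i j hij => hc.tri.lor_neg hij)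
    fun i j hij => (hd i j hij).trans (hl' i j hij)

end Unique

/-! ### Disjointness of the tiles -/

section Tiles

variable {ρ₀ : Representation ℝ F2 V} {n₀ : V}

theorem isCocycle_coe (u : groupCohomology.cocycles₁ (Rep.of ρ₀)) :
    IsCocycle ρ₀ (fun g => u g) :=
  fun g h => (groupCohomology.mem_cocycles₁_iff (A := Rep.of ρ₀) u.1).1 u.2 g h

theorem exists_hasCoord_of_mem_tileCone {b : Superbasis}
    {u : groupCohomology.cocycles₁ (Rep.of ρ₀)}
    (h : groupCohomology.H1π (Rep.of ρ₀) u ∈ tileCone ρ₀ n₀ b) :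
    ∃ (T : BasicTriple) (l : Fin 3 → ℝ), Quot.mk _ T = b ∧
      HasCoord ρ₀ n₀ (fun g => u g) T l ∧ ∀ i, 0 < l i := by
  obtain ⟨T, t, n, s, O, q, u', hT, ⟨ht, hA, hB, hC⟩, htri, horb, hq, hres, hu⟩ := h
  rw [groupCohomology.H1π_eq_iff] at hu
  obtain ⟨v, hv⟩ := hu
  have hv' : ∀ g, u g = u' g + (ρ₀ g v - v) := by
    intro g
    have h1 : ρ₀ g v - v = u g - u' g := congrFun hv g
    rw [h1]; abel
  have htr : IsTriangle t n s := ⟨ht, htri⟩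
  have hs : ∀ i, lor (s i) (s i) = 1 := by
    obtain ⟨-, -, h0, h1, h2⟩ := htri
    intro i
    fin_cases i <;> [exact h0.1; exact h1.1; exact h2.1]
  -- The two cocycles differ by the coboundary of `v`, so a translation by `-v` carries the
  -- configuration of `u'` to one of `u`.
  obtain ⟨l, hl0, hl⟩ := exists_isStripCoord_of_transSemigroup (O - v) ht hs htr.lor_self hq
  refine ⟨T, l, hT, ⟨t, n, s, _, ⟨htr, ?_, horb, ?_⟩, hl, ?_⟩, hl0⟩
  · exact fun x => ⟨LinearMap.congr_fun hA x, LinearMap.congr_fun hB x, LinearMap.congr_fun hC x⟩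
  · have e : ∀ i x, particleInv (t i) (O - v + q i) x =
        particleInv (t i) (O + q i) (x + v) - v := by
      intro i x
      rw [particleInv_apply, particleInv_apply,
        show x - (O - v + q i) = x + v - (O + q i) by abel]
      abel
    have e' : ∀ g x, ρ₀ g x + u g = ρ₀ g (x + v) + u' g - v := by
      intro g x
      rw [hv', map_add]
      abel
    intro x
    obtain ⟨r1, r2, r3⟩ := hres (x + v)
    simp only [e, e', sub_add_cancel]
    exact ⟨by rw [r1], by rw [r2], by rw [r3]⟩
  · intro i j hij
    rw [hl i j hij]
    have h1 := htr.lor_neg hij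
    have h2 := htr.lor_neg hij.symm
    have := hl0 i
    have := hl0 j
    nlinarith

/-- Conjugate the whole configuration by the homothety of ratio `r`. -/
theorem smul_mem_tileCone {b : Superbasis} {c : DefSpace ρ₀} (h : c ∈ tileCone ρ₀ n₀ b) {r : ℝ}
    (hr : 0 < r) : r • c ∈ tileCone ρ₀ n₀ b := by
  obtain ⟨T, t, n, s, O, q, u, hT, hcox, htri, horb, hq, hres, rfl⟩ := h
  refine ⟨T, t, n, s, r • O, fun i => r • q i, r • u, hT, hcox, htri, horb, fun i => ?_, ?_,
    (map_smul _ _ _).symm⟩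
  · obtain ⟨m, hm, p, hp, h1, h2, h3, a, b, ha, hb, e⟩ := hq i
    exact ⟨m, hm, p, hp, h1, h2, h3, r * a, r * b, mul_pos hr ha, mul_pos hr hb, by
      simp only [e, smul_sub, smul_smul]⟩
  · have e : ∀ i x, particleInv (t i) (r • O + r • q i) x =
        r • particleInv (t i) (O + q i) (r⁻¹ • x) := by
      intro i x
      have : x - (r • O + r • q i) = r • (r⁻¹ • x - (O + q i)) := by
        rw [smul_sub, smul_smul, mul_inv_cancel₀ hr.ne', one_smul, smul_add]
      rw [particleInv_apply, particleInv_apply, this, map_smul]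
      module
    have e' : ∀ g x, ρ₀ g x + (r • u) g = r • (ρ₀ g (r⁻¹ • x) + u g) := by
      intro g x
      rw [smul_add, ← map_smul, smul_smul, mul_inv_cancel₀ hr.ne', one_smul]
      rfl
    intro x
    obtain ⟨r1, r2, r3⟩ := hres (r⁻¹ • x)
    simp only [e, e', smul_smul, inv_mul_cancel₀ hr.ne', one_smul]
    exact ⟨by rw [r1], by rw [r2], by rw [r3]⟩

theorem eq_of_mem_tileCone (hρ₀ : IsOneHoledTorus ρ₀) {b b' : Superbasis} {c : DefSpace ρ₀}
    (h : c ∈ tileCone ρ₀ n₀ b) (h' : c ∈ tileCone ρ₀ n₀ b') : b = b' := by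
  induction c using groupCohomology.H1_induction_on with | _ u
  obtain ⟨T, l, rfl, hl, hpos⟩ := exists_hasCoord_of_mem_tileCone h
  obtain ⟨T', l', rfl, hl', hpos'⟩ := exists_hasCoord_of_mem_tileCone h'
  rcases T.connected T' with hs | ⟨k, hk⟩
  · exact hs.mk_eq.symm
  · obtain ⟨m, hm, hneg, -⟩ := hk.exists_hasCoord hρ₀.isSO21 (isCocycle_coe u) hl hpos
    rw [hm.unique hρ₀ hl'] at hneg
    exact absurd hneg (hpos' k).not_gt

end Tiles

end OneHoledTorus

end

theorem mainTheorem3 (ρ₀ : Representation ℝ OneHoledTorus.F2 OneHoledTorus.V)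
    (hρ₀ : OneHoledTorus.IsOneHoledTorus ρ₀) (n₀ : OneHoledTorus.V)
    (hn₀ : OneHoledTorus.IsBoundaryFixedPoint ρ₀ n₀)
    (b b' : OneHoledTorus.Superbasis) (hbb' : b ≠ b') :
    Disjoint (OneHoledTorus.tileCone ρ₀ n₀ b) (OneHoledTorus.tileCone ρ₀ n₀ b') ∧
      Disjoint (OneHoledTorus.tile ρ₀ n₀ b) (OneHoledTorus.tile ρ₀ n₀ b') := by
  refine ⟨Set.disjoint_left.2 fun c h h' => hbb' (OneHoledTorus.eq_of_mem_tileCone hρ₀ h h'),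
    Set.disjoint_left.2 ?_⟩
  rintro _ ⟨c, hc, h, rfl⟩ ⟨c', hc', h', hr⟩
  rw [ray_eq_iff] at hr
  -- Equal directions have a common positive multiple, which lies in both cones.
  obtain ⟨r₁, r₂, hr₁, hr₂, e⟩ := hr.exists_pos hc hc'
  refine hbb' (OneHoledTorus.eq_of_mem_tileCone hρ₀
    (OneHoledTorus.smul_mem_tileCone h hr₁) ?_)
  rw [e]
  exact OneHoledTorus.smul_mem_tileCone h' hr₂
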